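/- **Theorem (the Robinson tiles are an aperiodic set).** Let $Q=[-\tfrac12,\tfrac12]^2$. Robinson's six tiles are the following marked copies of the unit square $Q$. * Two *cross* tiles. Each has a bump at the midpoint of every edge, and an elbow-shaped line with ends at $(\tfrac14,\tfrac12)$ and $(\tfrac12,\tfrac14)$. All four vertices of the first cross tile are cornerless, and all four vertices of the second are cornered. * Four *passing* tiles. Each has a bump at the midpoint of the top edge, nicks at the midpoints of the other three edges, and four cornerless vertices. Independently, a line with ends $(\tfrac14,-\tfrac12)$ and $(\tfrac14,\tfrac12)$ may be present or absent, and a line with ends $(-\tfrac12,-\tfrac14)$ and $(\tfrac12,-\tfrac14)$ may be present or absent. A *tessellation* by these tiles is a set of copies of them under isometries of the Euclidean plane (rotations and reflections are allowed) such that the squares cover the plane and have pairwise disjoint interiors, every bump lies in a nick of another tile and every nick holds a bump of another tile, every end of a line on the boundary of a tile is also an end of a line of another tile, and every vertex of a tile is a cornered vertex of exactly one tile. It is *periodic* if some nonzero translation leaves it invariant. Two tessellations are *congruent* if an isometry of the plane carries one onto the other. The Robinson tiles admit a tessellation of the plane, and no tessellation that they admit is periodic. Moreover, they admit uncountably many pairwise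 non-congruent tessellations. -/

import Mathlib

/-- The Euclidean plane. -/
abbrev Plane : Type := EuclideanSpace ℝ (Fin 2)

/-- The point of the plane with coordinates `x`, `y`. -/
noncomputable def pt (x y : ℝ) : Plane := !₂[x, y]

/-- A marked tile: a region of the plane, together with the points of its boundary where it has
a bump, a nick, an end of one of the lines painted on it, a cornered vertex (the tile fills
up the small gap at this vertex) or a cornerless vertex (the tile is cut away at this vertex). -/
@[ext] structure MarkedTile where
  region : Set Plane
  bumps : Set Plane
  nicks : Set Plane
  lineEnds : Set Plane
  cornered : Set Plane
  cornerless : Set Plane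

/-- The copy of a marked tile under an isometry of the plane (a reflection is allowed). -/
def MarkedTile.map (g : Plane ≃ᵢ Plane) (t : MarkedTile) : MarkedTile where
  region := g '' t.region
  bumps := g '' t.bumps
  nicks := g '' t.nicks
  lineEnds := g '' t.lineEnds
  cornered := g '' t.cornered
  cornerless := g '' t.cornerless

/-- `T` is a tessellation of the plane admitted by the set `P` of marked tiles: `T` consists of
copies of tiles in `P`, without gaps or overlaps, that fit together: every bump sits in a nick,
every nick holds a bump, every line ending on the boundary of a tile goes on in another tile,
and the gap at each vertex is filled by exactly one tile that is cornered there. -/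
structure IsTessellation (P : Set MarkedTile) (T : Set MarkedTile) : Prop where
  copies : ∀ t ∈ T, ∃ p ∈ P, ∃ g : Plane ≃ᵢ Plane, t = p.map g
  covers : ∀ x : Plane, ∃ t ∈ T, x ∈ t.region
  no_overlap : ∀ t ∈ T, ∀ t' ∈ T, t ≠ t' → Disjoint (interior t.region) (interior t'.region)
  bump_fits : ∀ t ∈ T, ∀ x ∈ t.bumps, ∃ t' ∈ T, x ∈ t'.nicks
  nick_fits : ∀ t ∈ T, ∀ x ∈ t.nicks, ∃ t' ∈ T, x ∈ t'.bumps
  line_fits : ∀ t ∈ T, ∀ x ∈ t.lineEnds, ∃ t' ∈ T, t' ≠ t ∧ x ∈ t'.lineEnds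
  corner_fits : ∀ t ∈ T, ∀ x ∈ t.cornered ∪ t.cornerless, ∃! t', t' ∈ T ∧ x ∈ t'.cornered

/-- A tessellation is periodic if some nonzero translation leaves it invariant. -/
def IsPeriodic (T : Set MarkedTile) : Prop :=
  ∃ v : Plane, v ≠ 0 ∧ MarkedTile.map (IsometryEquiv.addRight v) '' T = T

/-- Two tessellations are congruent if an isometry of the plane carries one onto the other. -/
def AreCongruent (T T' : Set MarkedTile) : Prop :=
  ∃ g : Plane ≃ᵢ Plane, MarkedTile.map g '' T = T'

/-- A set of tiles is aperiodic if it admits a tessellation, but no periodic one. -/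
def IsAperiodicSet (P : Set MarkedTile) : Prop :=
  (∃ T, IsTessellation P T) ∧ ∀ T, IsTessellation P T → ¬ IsPeriodic T

/-- The closed unit square centred at the origin. -/
def unitSquare : Set Plane := {p | |p 0| ≤ 1 / 2 ∧ |p 1| ≤ 1 / 2}

/-- The four vertices of the unit square. -/
def squareVertices : Set Plane := {p | |p 0| = 1 / 2 ∧ |p 1| = 1 / 2}

/-- The cross tiles, one cornered and one cornerless: a bump on each edge, and an elbow that
points up and to the right, a line joining a point of the top edge to a point of the right
edge. -/
noncomputable def crossTile (isCornered : Bool) : MarkedTile where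
  region := unitSquare
  bumps := {pt 0 (1 / 2), pt (1 / 2) 0, pt 0 (-1 / 2), pt (-1 / 2) 0}
  nicks := ∅
  lineEnds := {pt (1 / 4) (1 / 2), pt (1 / 2) (1 / 4)}
  cornered := if isCornered then squareVertices else ∅
  cornerless := if isCornered then ∅ else squareVertices

/-- The four passing tiles, all cornerless: a bump on the top edge and a nick on each of the
others. If `along`, a line runs from the bottom edge to the top edge, on the right of the
midpoints. If `across`, a line runs from the left edge to the right edge, below the midpoints,
that is, on the side away from the bump. -/
noncomputable def passingTile (along across : Bool) : MarkedTile where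
  region := unitSquare
  bumps := {pt 0 (1 / 2)}
  nicks := {pt (1 / 2) 0, pt 0 (-1 / 2), pt (-1 / 2) 0}
  lineEnds :=
    (if along then {pt (1 / 4) (1 / 2), pt (1 / 4) (-1 / 2)} else ∅) ∪
    (if across then {pt (1 / 2) (-1 / 4), pt (-1 / 2) (-1 / 4)} else ∅)
  cornered := ∅
  cornerless := squareVertices

/-- Robinson's six tiles. -/
noncomputable def robinsonTiles : Set MarkedTile :=
  {crossTile false, passingTile false false, passingTile true false, passingTile false true,
    passingTile true true, crossTile true}

/-! Read a bump as the head of an arrow leaving the tile. Every edge midpoint of a Robinson tile is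
a bump or a nick, and two unit squares that do not overlap and share an edge midpoint share the
edge. Hence each tessellation is congruent to one with a tile at each point of `ℤ × ℤ`
(`IsTessellation.exists_lattice`), and its markings form a `RobinsonField`.

No period: the cornered crosses occur exactly once in each 2 × 2 block. Suppose that the crosses of
level `n` have mutual distance at least `2 * 2 ^ n` and that every block of that side contains one.
Around such a cross all arrows point out of the block of side `2 * 2 ^ n - 1`, and only the two
lines of its elbow leave it (`collar`). A line of the elbow must reach another cross of level `n`,
at distance exactly `2 * 2 ^ n` (`neighbour_mem`), so the crosses form squares of four that face a
common centre (`parent`). The arrows and lines in the corridors between the four blocks make this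
centre a cross with a collar twice as wide (`collar_step`), and the centres are again separated and
covering, on twice the scale. A period carries each level into itself, so it is smaller than the
separation of some level and must be `0`.

Existence: let `s` be a 2-adic integer that is not an ordinary integer, so that each `s + x` has a
finite valuation `lev x`. Put a cross at `(x, y)` if `lev x = lev y` and a passing tile otherwise,
with markings read off the binary digits (`RulerMarks`). Adjacent tiles read the same digits, so
they fit.

Uncountably many: the tiling determines `s` (`IsRuler.eq_of_marks`). An isometry between two of
these tilings carries three bumps of the cross at the origin into the countable set of quarter
points and is determined by their images, so every congruence class in the family is countable. -/

/-! ### Frames of the lattice and Robinson's rules -/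

/-- The pair `(u, w)` is one of the eight orthonormal bases of the lattice `ℤ × ℤ`. -/
def IsFrame (u w : ℤ × ℤ) : Prop :=
  u.1 ^ 2 + u.2 ^ 2 = 1 ∧ w.1 ^ 2 + w.2 ^ 2 = 1 ∧ u.1 * w.1 + u.2 * w.2 = 0

namespace IsFrame

variable {u w a b : ℤ × ℤ}

theorem symm (h : IsFrame u w) : IsFrame w u :=
  ⟨h.2.1, h.1, by have := h.2.2; linarith⟩

theorem neg_left (h : IsFrame u w) : IsFrame (-u) w := by
  obtain ⟨h1, h2, h3⟩ := h
  refine ⟨?_, h2, ?_⟩ <;> simp only [Prod.fst_neg, Prod.snd_neg] <;> linarith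

theorem neg_right (h : IsFrame u w) : IsFrame u (-w) := h.symm.neg_left.symm

theorem std : IsFrame (1, 0) (0, 1) := by simp [IsFrame]

theorem eq_or (h : IsFrame u w) :
    ((u = (1, 0) ∨ u = (-1, 0)) ∧ (w = (0, 1) ∨ w = (0, -1))) ∨
      ((u = (0, 1) ∨ u = (0, -1)) ∧ (w = (1, 0) ∨ w = (-1, 0))) := by
  obtain ⟨u1, u2⟩ := u
  obtain ⟨w1, w2⟩ := w
  obtain ⟨h1, h2, h3⟩ := h
  simp only at h1 h2 h3
  have b1 : -1 ≤ u1 ∧ u1 ≤ 1 := by constructor <;> nlinarith [sq_nonneg u2]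
  have b2 : -1 ≤ u2 ∧ u2 ≤ 1 := by constructor <;> nlinarith [sq_nonneg u1]
  have b3 : -1 ≤ w1 ∧ w1 ≤ 1 := by constructor <;> nlinarith [sq_nonneg w2]
  have b4 : -1 ≤ w2 ∧ w2 ≤ 1 := by constructor <;> nlinarith [sq_nonneg w1]
  obtain ⟨b1, b1'⟩ := b1
  obtain ⟨b2, b2'⟩ := b2
  obtain ⟨b3, b3'⟩ := b3
  obtain ⟨b4, b4'⟩ := b4
  interval_cases u1 <;> interval_cases u2 <;> simp at h1 <;> interval_cases w1 <;>
    interval_cases w2 <;> simp at h2 h3 ⊢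

/-- Two frames differ by signs and an exchange of the axes, so statements about a single tile reduce
to eight cases without coordinates. -/
theorem rel (h : IsFrame u w) (h' : IsFrame a b) :
    ((a = u ∨ a = -u) ∧ (b = w ∨ b = -w)) ∨ ((a = w ∨ a = -w) ∧ (b = u ∨ b = -u)) := by
  obtain ⟨rfl | rfl, rfl | rfl⟩ | ⟨rfl | rfl, rfl | rfl⟩ := h.eq_or <;>
  obtain ⟨rfl | rfl, rfl | rfl⟩ | ⟨rfl | rfl, rfl | rfl⟩ := h'.eq_or <;> decide

theorem ne_all (h : IsFrame u w) :
    u ≠ w ∧ u ≠ -w ∧ w ≠ u ∧ w ≠ -u ∧ u ≠ -u ∧ w ≠ -w ∧ -u ≠ u ∧ -w ≠ w ∧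
      -u ≠ w ∧ -w ≠ u := by
  obtain ⟨rfl | rfl, rfl | rfl⟩ | ⟨rfl | rfl, rfl | rfl⟩ := h.eq_or <;> decide

theorem coords_eq_zero (h : IsFrame u w) {i j : ℤ} (e : i • u + j • w = 0) : i = 0 ∧ j = 0 := by
  have e1 := congrArg Prod.fst e
  have e2 := congrArg Prod.snd e
  obtain ⟨rfl | rfl, rfl | rfl⟩ | ⟨rfl | rfl, rfl | rfl⟩ := h.eq_or <;> simp at e1 e2 <;>
    omega

end IsFrame

/-- The markings of a tiling of the plane by Robinson tiles centred at the points of `ℤ × ℤ`,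
subject to Robinson's rules: `out z d` says that the tile at `z` has a bump on its edge in
direction `d`, `line z d w` that it has a line end on this edge, displaced in direction `w`,
and `crn z` that it is the cornered cross tile. -/
structure RobinsonField (out : ℤ × ℤ → ℤ × ℤ → Prop) (line : ℤ × ℤ → ℤ × ℤ → ℤ × ℤ → Prop)
    (crn : ℤ × ℤ → Prop) : Prop where
  out_iff : ∀ z u w, IsFrame u w → (out (z + u) (-u) ↔ ¬ out z u)
  line_iff : ∀ z u w, IsFrame u w → (line (z + u) (-u) w ↔ line z u w)
  tile : ∀ z, ∃ u w, IsFrame u w ∧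
    (((∀ a b, IsFrame a b → out z a) ∧
      ∀ a b, IsFrame a b → (line z a b ↔ (a = u ∧ b = w) ∨ (a = w ∧ b = u))) ∨
    ((∀ a b, IsFrame a b → (out z a ↔ a = w)) ∧ ∃ al ac : Prop,
      ∀ a b, IsFrame a b → (line z a b ↔
        (al ∧ (a = w ∨ a = -w) ∧ b = u) ∨ (ac ∧ (a = u ∨ a = -u) ∧ b = -w))))
  crn_out : ∀ z a b, crn z → IsFrame a b → out z a
  crn_exists : ∀ z u w, IsFrame u w → crn z ∨ crn (z + u) ∨ crn (z + w) ∨ crn (z + u + w)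
  crn_unique : ∀ z u w, IsFrame u w → crn z → ¬ crn (z + u) ∧ ¬ crn (z + u + w)

namespace RobinsonField

variable {out : ℤ × ℤ → ℤ × ℤ → Prop} {line : ℤ × ℤ → ℤ × ℤ → ℤ × ℤ → Prop}
  {crn : ℤ × ℤ → Prop} {z a b : ℤ × ℤ}

/-- A tile with a nick on one edge has at most one bump. -/
theorem passing (F : RobinsonField out line crn) (h : IsFrame a b) (ha : ¬ out z a) :
    ∃ u w, IsFrame u w ∧ (∀ a b, IsFrame a b → (out z a ↔ a = w)) ∧ ∃ al ac : Prop,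
      ∀ a b, IsFrame a b → (line z a b ↔
        (al ∧ (a = w ∨ a = -w) ∧ b = u) ∨ (ac ∧ (a = u ∨ a = -u) ∧ b = -w)) := by
  obtain ⟨u, w, hf, h1 | h1⟩ := F.tile z
  · exact absurd (h1.1 a b h) ha
  · exact ⟨u, w, hf, h1⟩

theorem out_of_sides (F : RobinsonField out line crn) (h : IsFrame a b) (h1 : ¬ out z a)
    (h2 : ¬ out z (-a)) (h3 : ¬ out z (-b)) : out z b := by
  obtain ⟨u, w, hf, ho, -⟩ := F.passing h h1
  rw [ho _ _ h] at h1
  rw [ho _ _ h.neg_left] at h2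
  rw [ho _ _ h.symm.neg_left] at h3
  rw [ho _ _ h.symm]
  obtain ⟨rfl | rfl, rfl | rfl⟩ | ⟨rfl | rfl, rfl | rfl⟩ := hf.rel h <;> simp_all

theorem not_out_opp (F : RobinsonField out line crn) (h : IsFrame a b) (h1 : ¬ out z a)
    (h2 : out z b) : ¬ out z (-b) := by
  obtain ⟨u, w, hf, ho, -⟩ := F.passing h h1
  rw [ho _ _ h.symm] at h2
  rw [ho _ _ h.symm.neg_left, h2]
  exact hf.ne_all.2.2.2.2.2.2.2.1

theorem not_out_side (F : RobinsonField out line crn) (h : IsFrame a b) (h1 : ¬ out z a)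
    (h2 : out z (-a)) : ¬ out z b := by
  obtain ⟨u, w, hf, ho, -⟩ := F.passing h h1
  rw [ho _ _ h.neg_left] at h2
  rw [ho _ _ h.symm, ← h2]
  exact h.ne_all.2.2.2.1

/-- Nicks on both edges `a` and `-a` put the bump on the other axis. A line through the edge `a` is
then the transverse one, which is drawn on the side away from the bump. This is how a line forces
the direction of an arrow. -/
theorem across (F : RobinsonField out line crn) (h : IsFrame a b) (h1 : ¬ out z a)
    (h2 : ¬ out z (-a)) (h3 : line z a b) : out z (-b) ∧ line z (-a) b := by
  obtain ⟨u, w, hf, ho, al, ac, hl⟩ := F.passing h h1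
  rw [ho _ _ h] at h1
  rw [ho _ _ h.neg_left] at h2
  rw [hl _ _ h] at h3
  rw [ho _ _ h.symm.neg_left, hl _ _ h.neg_left]
  have := hf.ne_all
  obtain ⟨rfl | rfl, rfl | rfl⟩ | ⟨rfl | rfl, rfl | rfl⟩ := hf.rel h <;> simp_all

theorem not_line (F : RobinsonField out line crn) (h : IsFrame a b) (h1 : ¬ out z a)
    (h2 : out z b) : ¬ line z a b := by
  obtain ⟨u, w, hf, ho, al, ac, hl⟩ := F.passing h h1
  rw [ho _ _ h] at h1
  rw [ho _ _ h.symm] at h2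
  rw [hl _ _ h]
  have := hf.ne_all
  obtain ⟨rfl | rfl, rfl | rfl⟩ | ⟨rfl | rfl, rfl | rfl⟩ := hf.rel h <;> simp_all

theorem along (F : RobinsonField out line crn) (h : IsFrame a b) (h1 : ¬ out z a)
    (h2 : ¬ out z (-a)) : line z b a ↔ line z (-b) a := by
  obtain ⟨u, w, hf, ho, al, ac, hl⟩ := F.passing h h1
  rw [ho _ _ h] at h1
  rw [ho _ _ h.neg_left] at h2
  rw [hl _ _ h.symm, hl _ _ h.symm.neg_left]
  have := hf.ne_all
  obtain ⟨rfl | rfl, rfl | rfl⟩ | ⟨rfl | rfl, rfl | rfl⟩ := hf.rel h <;> simp_all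

/-- A tile with four bumps is a cross. -/
theorem cross (F : RobinsonField out line crn) (hz : ∀ a b, IsFrame a b → out z a) :
    ∃ u w, IsFrame u w ∧
      ∀ a b, IsFrame a b → (line z a b ↔ (a = u ∧ b = w) ∨ (a = w ∧ b = u)) := by
  obtain ⟨u, w, hf, h1 | h1⟩ := F.tile z
  · exact ⟨u, w, hf, h1.2⟩
  · have := (h1.1 _ _ hf).1 (hz _ _ hf)
    exact absurd this hf.ne_all.1

end RobinsonField

/-! ### The hierarchy of crosses and their collars -/

/-- The hierarchy of crosses: level `0` consists of the cornered crosses, and a point belongs to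
level `n + 1` if its four neighbours at distance `2 ^ n` belong to level `n` and their elbows
point to it. -/
def Level (line : ℤ × ℤ → ℤ × ℤ → ℤ × ℤ → Prop) (crn : ℤ × ℤ → Prop) : ℕ → ℤ × ℤ → Prop
  | 0, z => crn z
  | n + 1, c => ∀ u w, IsFrame u w → Level line crn n (c + (2 ^ n : ℤ) • (u + w)) ∧
      line (c + (2 ^ n : ℤ) • (u + w)) (-u) (-w)

namespace RobinsonField

variable {out : ℤ × ℤ → ℤ × ℤ → Prop} {line : ℤ × ℤ → ℤ × ℤ → ℤ × ℤ → Prop}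
  {crn : ℤ × ℤ → Prop} {z a b u w c : ℤ × ℤ} {n : ℕ}

theorem cross_line (F : RobinsonField out line crn) (hz : ∀ a b, IsFrame a b → out z a)
    (h : IsFrame a b) (hl : line z a b) :
    line z b a ∧ ¬ line z (-a) b ∧ ¬ line z (-a) (-b) ∧ ¬ line z a (-b) := by
  obtain ⟨u, w, hf, hc⟩ := F.cross hz
  rw [hc _ _ h] at hl
  rw [hc _ _ h.symm, hc _ _ h.neg_left, hc _ _ h.neg_left.neg_right, hc _ _ h.neg_right]
  have := hf.ne_all
  obtain ⟨rfl | rfl, rfl | rfl⟩ | ⟨rfl | rfl, rfl | rfl⟩ := hf.rel h <;> simp_all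

theorem exists_cross_line (F : RobinsonField out line crn) (hz : ∀ a b, IsFrame a b → out z a)
    (h : IsFrame a b) :
    ∃ u w, IsFrame u w ∧ (u = a ∨ u = -a) ∧ (w = b ∨ w = -b) ∧ line z u w := by
  obtain ⟨u, w, hf, hc⟩ := F.cross hz
  rcases h.rel hf with h1 | h1
  · exact ⟨u, w, hf, h1.1, h1.2, (hc _ _ hf).2 (by simp)⟩
  · exact ⟨w, u, hf.symm, h1.2, h1.1, (hc _ _ hf.symm).2 (by simp)⟩

/-- Along the sides of the block of size `2 ^ (n + 1) - 1` around a cross of level `n`, all arrows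
point outwards, and the only lines that leave the block are those that start in the cross. -/
def Collar (out : ℤ × ℤ → ℤ × ℤ → Prop) (line : ℤ × ℤ → ℤ × ℤ → ℤ × ℤ → Prop) (h : ℤ)
    (z : ℤ × ℤ) : Prop :=
  (∀ a b, IsFrame a b → out z a) ∧ ∀ u w, IsFrame u w → ∀ j : ℤ, |j| < h →
    ¬ out (z + h • u + j • w) (-u) ∧
      (line (z + h • u + j • w) (-u) w ↔ j = 0 ∧ line z u w)

section arm

variable {h : ℤ}

/-- The arm from `c` in direction `u` runs along a side of the block around `c + h • (u + w)`, whose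
arrows point out of the block and into the arm. -/
theorem arm_sides (hC : ∀ u w, IsFrame u w → Collar out line h (c + h • (u + w)) ∧
      line (c + h • (u + w)) (-u) (-w)) (hf : IsFrame u w) {i : ℤ} (h0 : 0 < i)
    (h1 : i < 2 * h) : ¬ out (c + i • u) w := by
  have := ((hC u w hf).1.2 (-w) u hf.symm.neg_left (i - h) (by rw [abs_lt]; omega)).1
  rwa [show c + h • (u + w) + h • -w + (i - h) • u = c + i • u by module, neg_neg] at this

/-- An elbow line of a neighbouring cross passes through the middle of the arm, displaced towards
`c`, so the arrow there points away from `c`. With nicks on both sides of the arm, this direction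
propagates outwards to its end and inwards to `c`, which thereby gets four bumps. -/
theorem arm_out (F : RobinsonField out line crn)
    (hC : ∀ u w, IsFrame u w → Collar out line h (c + h • (u + w)) ∧
      line (c + h • (u + w)) (-u) (-w)) (hh : 0 < h) (hf : IsFrame u w) :
    ∀ i, 0 ≤ i → i < 2 * h → out (c + i • u) u := by
  have mid : out (c + h • u) u := by
    have h1 := ((hC u w hf).1.2 (-w) (-u) hf.symm.neg_left.neg_right 0 (by simpa using hh)).2
    rw [show c + h • (u + w) + h • -w + (0 : ℤ) • -u = c + h • u by module, neg_neg] at h1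
    have hx : ∀ a b, IsFrame a b → out (c + h • (u + w)) a := (hC u w hf).1.1
    have h2 := h1.2 ⟨rfl, (F.cross_line hx hf.neg_left.neg_right (hC u w hf).2).1⟩
    simpa using (F.across hf.symm.neg_right (arm_sides hC hf hh (by omega))
      (arm_sides hC hf.neg_right hh (by omega)) h2).1
  intro i h0 h1
  rcases le_total h i with hi | hi
  · revert h1
    refine Int.leInduction (motive := fun i _ => i < 2 * h → out (c + i • u) u)
      (fun _ => mid) (fun k hk ih hk' => ?_) i hi
    have := (F.out_iff _ _ _ hf).not.2 (not_not.2 (ih (by omega)))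
    rw [show c + k • u + u = c + (k + 1) • u by module] at this
    exact F.out_of_sides hf.symm (arm_sides hC hf (by omega) hk')
      (arm_sides hC hf.neg_right (by omega) hk') this
  · revert h0
    refine Int.leInductionDown (motive := fun i _ => 0 ≤ i → out (c + i • u) u)
      (fun _ => mid) (fun k hk ih hk' => ?_) i hi
    have := F.not_out_opp hf.symm (arm_sides hC hf (by omega) (by omega)) (ih (by omega))
    by_contra hn
    rw [← F.out_iff _ _ _ hf] at hn
    rw [show c + (k - 1) • u + u = c + k • u by module] at hn
    exact this hn

theorem arm_line (F : RobinsonField out line crn)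
    (hC : ∀ u w, IsFrame u w → Collar out line h (c + h • (u + w)) ∧
      line (c + h • (u + w)) (-u) (-w)) (hf : IsFrame u w) :
    ∀ i, 0 ≤ i → i < 2 * h → (line (c + i • u) u w ↔ line c u w) := by
  intro i h0
  refine Int.leInduction (motive := fun i _ => i < 2 * h → (line (c + i • u) u w ↔ line c u w))
    (fun _ => by simp) (fun k hk ih hk' => ?_) i h0
  rw [← ih (by omega), F.along hf.symm (arm_sides hC hf (by omega) hk')
      (arm_sides hC hf.neg_right (by omega) hk'), ← F.line_iff _ _ _ hf,
    show c + k • u + u = c + (k + 1) • u by module]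

/-- A side of the large block consists of sides of two small blocks and the end of an arm between
them. The small crosses point inwards, so no line of theirs leaves there; what leaves through the
arm is what starts at `c`. -/
theorem collar_step (F : RobinsonField out line crn)
    (hC : ∀ u w, IsFrame u w → Collar out line h (c + h • (u + w)) ∧
      line (c + h • (u + w)) (-u) (-w)) (hh : 0 < h) : Collar out line (2 * h) c := by
  refine ⟨fun a b hf => by simpa using F.arm_out hC hh hf 0 le_rfl (by omega),
    fun u w hf j hj => ?_⟩
  rcases eq_or_ne j 0 with rfl | hj0
  · have h1 := F.arm_out hC hh hf (2 * h - 1) (by omega) (by omega)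
    have h2 := F.arm_line hC hf (2 * h - 1) (by omega) (by omega)
    have e : c + (2 * h) • u + (0 : ℤ) • w = c + (2 * h - 1) • u + u := by module
    rw [e, F.out_iff _ _ _ hf, F.line_iff _ _ _ hf, h2]
    exact ⟨not_not.2 h1, by simp⟩
  · have key : ∀ w, IsFrame u w → ∀ j : ℤ, 0 < j → j < 2 * h → ∀ b, IsFrame u b →
        ¬ out (c + (2 * h) • u + j • w) (-u) ∧ ¬ line (c + (2 * h) • u + j • w) (-u) b := by
      intro w hf j h0 h1 b hb
      have e : c + h • (u + w) + h • u + (j - h) • w = c + (2 * h) • u + j • w := by module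
      have e' : c + h • (u + w) + h • u + (h - j) • -w = c + (2 * h) • u + j • w := by module
      have hC1 := (hC u w hf).1.2 u w hf (j - h) (by rw [abs_lt]; omega)
      have hC2 := (hC u w hf).1.2 u (-w) hf.neg_right (h - j) (by rw [abs_lt]; omega)
      rw [e] at hC1
      rw [e'] at hC2
      have hx : ∀ a b, IsFrame a b → out (c + h • (u + w)) a := (hC u w hf).1.1
      have hl := F.cross_line hx hf.neg_left.neg_right (hC u w hf).2
      rw [neg_neg, neg_neg] at hl
      refine ⟨hC1.1, ?_⟩
      have hb' := hf.rel hb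
      have hne := hf.ne_all
      have hb' : b = w ∨ b = -w := by
        rcases hb' with h1 | h1
        · exact h1.2
        · rcases h1.1 with h1 | h1
          · exact absurd h1 hne.1
          · exact absurd h1 hne.2.1
      rcases hb' with rfl | rfl
      · rw [hC1.2]; exact fun h3 => hl.2.2.1 h3.2
      · rw [hC2.2]; exact fun h3 => hl.2.1 h3.2
    rw [abs_lt] at hj
    rcases lt_or_gt_of_ne hj0 with hj1 | hj1
    · have := key (-w) hf.neg_right (-j) (by omega) (by omega) w hf
      rw [show c + (2 * h) • u + -j • -w = c + (2 * h) • u + j • w by module] at this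
      exact ⟨this.1, fun h1 => absurd h1 this.2, fun h1 => absurd h1.1 hj0⟩
    · have := key w hf j hj1 (by omega) w hf
      exact ⟨this.1, fun h1 => absurd h1 this.2, fun h1 => absurd h1.1 hj0⟩

end arm

theorem collar (F : RobinsonField out line crn) (hz : Level line crn n z) :
    Collar out line (2 ^ n) z := by
  induction n generalizing z with
  | zero =>
    refine ⟨fun a b => F.crn_out z a b hz, fun u w hf j hj => ?_⟩
    obtain rfl : j = 0 := by simpa using hj
    have e : z + ((2 : ℤ) ^ 0) • u + (0 : ℤ) • w = z + u := by module
    rw [e, F.out_iff _ _ _ hf, F.line_iff _ _ _ hf]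
    exact ⟨not_not.2 (F.crn_out z _ _ hz hf), by simp⟩
  | succ n ih =>
    rw [pow_succ, mul_comm]
    exact F.collar_step (fun u w hf => ⟨ih (hz u w hf).1, (hz u w hf).2⟩) (by positivity)

/-! ### Separation and covering at every level -/

/-- Distinct points of `L` are at distance at least `N` in the maximum norm. -/
def _root_.Separated (L : ℤ × ℤ → Prop) (N : ℤ) : Prop :=
  ∀ p u w, IsFrame u w → ∀ i j : ℤ, |i| < N → |j| < N → L p → L (p + i • u + j • w) →
    i = 0 ∧ j = 0

/-- Every square block of side `N` contains a point of `L`. -/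
def _root_.Covering (L : ℤ × ℤ → Prop) (N : ℤ) : Prop :=
  ∀ y u w, IsFrame u w → ∃ i j : ℤ, 0 ≤ i ∧ i < N ∧ 0 ≤ j ∧ j < N ∧ L (y + i • u + j • w)

/-- Of the four crosses around `z` and the four around the other centre, take two that face each
other. They are less than `2 * 2 ^ n` apart, hence equal, and one elbow would have to point to both
centres. -/
theorem not_level_of_nonneg (F : RobinsonField out line crn)
    (hs : Separated (Level line crn n) (2 * 2 ^ n))
    (hf : IsFrame u w) {i j : ℤ} (h0 : 0 < i) (h1 : i < 4 * 2 ^ n) (h2 : 0 ≤ j)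
    (h3 : j < 4 * 2 ^ n) (hz : Level line crn (n + 1) z) :
    ¬ Level line crn (n + 1) (z + i • u + j • w) := by
  intro hz'
  have hp := hz u w hf
  have hl := F.cross_line (F.collar hp.1).1 hf.neg_left.neg_right hp.2
  rw [neg_neg, neg_neg] at hl
  rcases h2.eq_or_lt with rfl | h2
  · have hq := hz' (-u) w hf.neg_left
    have e : z + i • u + (0 : ℤ) • w + (2 ^ n : ℤ) • (-u + w) =
      z + (2 ^ n : ℤ) • (u + w) + (i - 2 * 2 ^ n) • u + (0 : ℤ) • w := by module
    rw [e, neg_neg] at hq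
    have h4 := hs _ u w hf (i - 2 * 2 ^ n) 0 (by rw [abs_lt]; omega)
      (by rw [abs_lt]; omega) hp.1 hq.1
    rw [h4.1, zero_smul, add_zero, zero_smul, add_zero] at hq
    exact hl.2.1 hq.2
  · have hq := hz' (-u) (-w) hf.neg_left.neg_right
    have e : z + i • u + j • w + (2 ^ n : ℤ) • (-u + -w) =
      z + (2 ^ n : ℤ) • (u + w) + (i - 2 * 2 ^ n) • u + (j - 2 * 2 ^ n) • w := by module
    rw [e, neg_neg, neg_neg] at hq
    have h4 := hs _ u w hf (i - 2 * 2 ^ n) (j - 2 * 2 ^ n) (by rw [abs_lt]; omega)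
      (by rw [abs_lt]; omega) hp.1 hq.1
    rw [h4.1, h4.2, zero_smul, zero_smul, add_zero, add_zero] at hq
    exact hl.2.2.1 hq.2

theorem _root_.Separated.of_nonneg {L : ℤ × ℤ → Prop} {N : ℤ}
    (H : ∀ z u w, IsFrame u w → ∀ i j : ℤ, 0 < i → i < N → 0 ≤ j → j < N → L z →
      ¬ L (z + i • u + j • w)) : Separated L N := by
  have H2 : ∀ z u w, IsFrame u w → ∀ i j : ℤ, 0 < i → i < N → |j| < N → L z →
      ¬ L (z + i • u + j • w) := by
    intro z u w hf i j h0 h1 h2 hz hz'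
    rw [abs_lt] at h2
    rcases le_total 0 j with h | h
    · exact H z u w hf i j h0 h1 h h2.2 hz hz'
    · refine H z u (-w) hf.neg_right i (-j) h0 h1 (by omega) (by omega) hz ?_
      rwa [show z + i • u + -j • -w = z + i • u + j • w by module]
  have H3 : ∀ z u w, IsFrame u w → ∀ i j : ℤ, i ≠ 0 → |i| < N → |j| < N → L z →
      ¬ L (z + i • u + j • w) := by
    intro z u w hf i j h0 h1 h2 hz hz'
    rw [abs_lt] at h1
    rcases lt_or_gt_of_ne h0 with h | h
    · refine H2 z (-u) w hf.neg_left (-i) j (by omega) (by omega) h2 hz ?_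
      rwa [show z + -i • -u + j • w = z + i • u + j • w by module]
    · exact H2 z u w hf i j h (by omega) h2 hz hz'
  intro z u w hf i j h1 h2 hz hz'
  constructor <;> by_contra h
  · exact H3 z u w hf i j h h1 h2 hz hz'
  · refine H3 z w u hf.symm j i h h2 h1 hz ?_
    rwa [add_right_comm]

theorem separated (F : RobinsonField out line crn) (n : ℕ) :
    Separated (Level line crn n) (2 * 2 ^ n) := by
  induction n with
  | zero =>
    refine Separated.of_nonneg fun z u w hf i j h0 h1 h2 h3 hz => ?_
    rw [pow_zero] at h1 h3
    obtain rfl : i = 1 := by omega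
    have := F.crn_unique z u w hf hz
    obtain rfl | rfl : j = 0 ∨ j = 1 := by omega
    · simpa [Level] using this.1
    · simpa [Level] using this.2
  | succ n ih =>
    refine Separated.of_nonneg fun z u w hf i j h0 h1 h2 h3 hz => ?_
    rw [pow_succ] at h1 h3
    exact F.not_level_of_nonneg ih hf h0 (by omega) h2 (by omega) hz

section neighbour

variable {L : ℤ × ℤ → Prop} {h : ℤ}

/-- Otherwise there are three blocks around `z` such that the arrows that run in the corridors
between them contradict the line that starts in `z` in direction `u`. -/
theorem neighbour_mem (F : RobinsonField out line crn) (hh : 0 < h)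
    (hs : Separated L (2 * h)) (hc : Covering L (2 * h)) (hC : ∀ z, L z → Collar out line h z)
    (hf : IsFrame u w) (hz : L z) (hl : line z u w) : L (z + (2 * h) • u) := by
  -- Separation from `z` puts this point of `L` in the last column of the block, at some height `b`.
  -- It remains to exclude `b > 0`.
  obtain ⟨i, b, hi0, hi1, hb0, hb1, hq⟩ := hc (z + u) u w hf
  obtain rfl : i = 2 * h - 1 := by
    by_contra hi
    rw [show z + u + i • u + b • w = z + (i + 1) • u + b • w by module] at hq
    have := hs z u w hf (i + 1) b (by rw [abs_lt]; omega) (by rw [abs_lt]; omega) hz hq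
    omega
  rw [show z + u + (2 * h - 1) • u + b • w = z + (2 * h) • u + b • w by module] at hq
  rcases hb0.eq_or_lt with rfl | hb0
  · simpa using hq
  exfalso
  -- Above `z`, separation from `z` forces the top row; separation from the point at height `b > 0`
  -- then forces the column of `z`.
  obtain ⟨a, j, ha0, ha1, hj0, hj1, hr⟩ := hc (z + w) u w hf
  obtain rfl : j = 2 * h - 1 := by
    by_contra hi
    rw [show z + w + a • u + j • w = z + a • u + (j + 1) • w by module] at hr
    have := hs z u w hf a (j + 1) (by rw [abs_lt]; omega) (by rw [abs_lt]; omega) hz hr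
    omega
  obtain rfl : a = 0 := by
    by_contra ha
    rw [show z + w + a • u + (2 * h - 1) • w =
      z + (2 * h) • u + b • w + (a - 2 * h) • u + (2 * h - b) • w by module] at hr
    have := hs _ u w hf (a - 2 * h) (2 * h - b) (by rw [abs_lt]; omega)
      (by rw [abs_lt]; omega) hq hr
    omega
  rw [show z + w + (0 : ℤ) • u + (2 * h - 1) • w = z + (2 * h) • w by module] at hr
  have below : ∀ x : ℤ, |x| < h → ¬ out (z + x • u + h • w) (-w) := fun x hx => by
    have := ((hC z hz).2 w u hf.symm x hx).1
    rwa [show z + h • w + x • u = z + x • u + h • w by module] at this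
  have above : ∀ x : ℤ, |x| < h → ¬ out (z + x • u + h • w) w := fun x hx => by
    have := ((hC _ hr).2 (-w) u hf.symm.neg_left x hx).1
    rwa [show z + (2 * h) • w + h • -w + x • u = z + x • u + h • w by module, neg_neg] at this
  -- In the corridor between the blocks of `z` and `z + (2 * h) • w`, the elbow line of `z` crosses
  -- at `x = 0`, displaced towards `u`. The arrow there points to `-u`, and so do the following
  -- ones.
  have row : ∀ x : ℤ, 0 ≤ x → x < h → ¬ out (z + x • u + h • w) u := by
    intro x hx
    refine Int.leInduction (motive := fun x _ => x < h → ¬ out (z + x • u + h • w) u)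
      (fun h1 => ?_) (fun x hx ih h1 => ?_) x hx
    · have h2 := ((hC z hz).2 w u hf.symm 0 (by simpa using hh)).2.2
        ⟨rfl, (F.cross_line (hC z hz).1 hf hl).1⟩
      rw [show z + h • w + (0 : ℤ) • u = z + (0 : ℤ) • u + h • w by module] at h2
      have h3 := (F.across hf.symm.neg_left (below 0 (by simpa using hh))
        (by simpa using above 0 (by simpa using hh)) h2).1
      simpa using F.not_out_opp hf.symm.neg_right (above 0 (by simpa using hh)) h3
    · have h2 := ih (by omega)
      rw [← F.out_iff _ _ _ hf,
        show z + x • u + h • w + u = z + (x + 1) • u + h • w by module] at h2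
      simpa using F.not_out_opp hf.symm.neg_right
        (above (x + 1) (by rw [abs_lt]; omega)) h2
  have hhout : out (z + h • u + h • w) (-u) := by
    have := row (h - 1) (by omega) (by omega)
    rwa [← F.out_iff _ _ _ hf,
      show z + (h - 1) • u + h • w + u = z + h • u + h • w by module] at this
  have hright : ¬ out (z + h • u + h • w) u := by
    have := ((hC _ hq).2 (-u) w hf.neg_left (h - b) (by rw [abs_lt]; omega)).1
    rwa [show z + (2 * h) • u + b • w + h • -u + (h - b) • w = z + h • u + h • w by module,
      neg_neg] at this
  -- The tile where the corridors meet has its bump towards `-u`, so its lower edge is a nick. The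
  -- arrows in the column below it therefore all point up.
  have col : ∀ y : ℤ, y ≤ h → 0 < y → ¬ out (z + h • u + y • w) (-w) := by
    intro y hy
    refine Int.leInductionDown (motive := fun y _ => 0 < y → ¬ out (z + h • u + y • w) (-w))
      (fun h1 => F.not_out_side hf.neg_right hright hhout) (fun y hy ih h1 => ?_) y hy
    have h2 := ih (by omega)
    have h3 := ((hC z hz).2 u w hf (y - 1) (by rw [abs_lt]; omega)).1
    rw [show z + h • u + y • w = z + h • u + (y - 1) • w + w by module,
      F.out_iff _ _ _ hf.symm, not_not] at h2
    exact F.not_out_opp hf.neg_left h3 h2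
  have hlast : out (z + h • u + (0 : ℤ) • w) w := by
    have h2 := col 1 (by omega) (by omega)
    rwa [show z + h • u + (1 : ℤ) • w = z + h • u + (0 : ℤ) • w + w by module,
      F.out_iff _ _ _ hf.symm, not_not] at h2
  have hin := (hC z hz).2 u w hf 0 (by simpa using hh)
  -- The tile at `z + h • u` has its bump towards `w`, yet the elbow line of `z` enters it displaced
  -- to that side.
  exact F.not_line hf.neg_left hin.1 hlast (hin.2.2 ⟨rfl, hl⟩)

/-- The line crosses the corridor at the middle of both blocks, and the collar of the second block
admits a line there only if it starts in the second cross. -/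
theorem neighbour (F : RobinsonField out line crn) (hh : 0 < h)
    (hs : Separated L (2 * h)) (hc : Covering L (2 * h)) (hC : ∀ z, L z → Collar out line h z)
    (hf : IsFrame u w) (hz : L z) (hl : line z u w) :
    L (z + (2 * h) • u) ∧ line (z + (2 * h) • u) (-u) w := by
  have hq := F.neighbour_mem hh hs hc hC hf hz hl
  have h1 := (hC z hz).2 u w hf 0 (by simpa using hh)
  have h2 := (hC _ hq).2 (-u) w hf.neg_left 0 (by simpa using hh)
  rw [show z + (2 * h) • u + h • -u + (0 : ℤ) • w = z + h • u + (0 : ℤ) • w by module,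
    neg_neg] at h2
  have h3 := (F.across hf.neg_left h1.1 (by simpa using h2.1) (h1.2.2 ⟨rfl, hl⟩)).2
  rw [neg_neg] at h3
  exact ⟨hq, (h2.2.1 h3).2⟩

/-- Following both elbow lines of `z`, and then the elbow of one of the crosses reached, visits all
corners of a square of side `2 * h`. The displacement of the lines makes every elbow face its
centre. -/
theorem parent (F : RobinsonField out line crn) (hh : 0 < h)
    (hs : Separated L (2 * h)) (hc : Covering L (2 * h)) (hC : ∀ z, L z → Collar out line h z)
    (hf : IsFrame u w) (hz : L z) (hl : line z u w) (hab : IsFrame a b) :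
    L (z + h • (u + w) + h • (a + b)) ∧ line (z + h • (u + w) + h • (a + b)) (-a) (-b) := by
  have swap : ∀ {x a b}, L x → IsFrame a b → line x a b → line x b a :=
    fun hx h1 h2 => (F.cross_line (hC _ hx).1 h1 h2).1
  have h1 := F.neighbour hh hs hc hC hf hz hl
  have h2 := F.neighbour hh hs hc hC hf.symm hz (swap hz hf hl)
  have h3 := F.neighbour hh hs hc hC hf.symm.neg_right h1.1 (swap h1.1 hf.neg_left h1.2)
  have e0 : z + h • (u + w) + h • (-u + -w) = z := by module
  have e1 : z + h • (u + w) + h • (u + -w) = z + (2 * h) • u := by module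
  have e2 : z + h • (u + w) + h • (-u + w) = z + (2 * h) • w := by module
  have e3 : z + h • (u + w) + h • (u + w) = z + (2 * h) • u + (2 * h) • w := by module
  have s0 := swap hz hf hl
  have s1 := swap h1.1 hf.neg_left h1.2
  have s2 := swap h2.1 hf.symm.neg_left h2.2
  have s3 := swap h3.1 hf.symm.neg_left.neg_right h3.2
  obtain ⟨rfl | rfl, rfl | rfl⟩ | ⟨rfl | rfl, rfl | rfl⟩ := hf.rel hab
  · rw [e3]; exact ⟨h3.1, s3⟩
  · rw [e1, neg_neg]; exact h1
  · rw [e2, neg_neg]; exact ⟨h2.1, s2⟩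
  · rw [e0, neg_neg, neg_neg]; exact ⟨hz, hl⟩
  · rw [add_comm a, e3]; exact h3
  · rw [add_comm a, e2, neg_neg]; exact h2
  · rw [add_comm (-w), e1, neg_neg]; exact ⟨h1.1, s1⟩
  · rw [add_comm (-w), e0, neg_neg, neg_neg]; exact ⟨hz, s0⟩

end neighbour

theorem covering (F : RobinsonField out line crn) (n : ℕ) :
    Covering (Level line crn n) (2 * 2 ^ n) := by
  induction n with
  | zero =>
    intro y u w hf
    obtain h | h | h | h := F.crn_exists y u w hf
    · exact ⟨0, 0, by norm_num, by norm_num, by norm_num, by norm_num, by simpa [Level] using h⟩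
    · exact ⟨1, 0, by norm_num, by norm_num, by norm_num, by norm_num, by simpa [Level] using h⟩
    · exact ⟨0, 1, by norm_num, by norm_num, by norm_num, by norm_num, by simpa [Level] using h⟩
    · exact ⟨1, 1, by norm_num, by norm_num, by norm_num, by norm_num, by simpa [Level] using h⟩
  | succ n ih =>
    intro y u w hf
    have hh : (0 : ℤ) < 2 ^ n := by positivity
    -- In the concentric block of half the side: the parent is `2 ^ n` away in both coordinates, so
    -- it stays in the large block.
    obtain ⟨i, j, hi0, hi1, hj0, hj1, hq⟩ := ih (y + (2 ^ n : ℤ) • (u + w)) u w hf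
    obtain ⟨a, b, hab, ha, hb, hl⟩ := F.exists_cross_line (F.collar hq).1 hf
    have hp : Level line crn (n + 1) _ := fun a' b' hab' =>
      F.parent hh (F.separated n) ih (fun _ => F.collar) hab hq hl hab'
    rw [pow_succ]
    obtain ⟨s, hs, rfl⟩ : ∃ s : ℤ, (s = 1 ∨ s = -1) ∧ a = s • u := by
      rcases ha with rfl | rfl
      exacts [⟨1, by simp⟩, ⟨-1, by simp⟩]
    obtain ⟨t, ht, rfl⟩ : ∃ t : ℤ, (t = 1 ∨ t = -1) ∧ b = t • w := by
      rcases hb with rfl | rfl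
      exacts [⟨1, by simp⟩, ⟨-1, by simp⟩]
    rw [show y + (2 ^ n : ℤ) • (u + w) + i • u + j • w + (2 ^ n : ℤ) • (s • u + t • w) =
      y + (2 ^ n + i + s * 2 ^ n) • u + (2 ^ n + j + t * 2 ^ n) • w by module] at hp
    refine ⟨_, _, ?_, ?_, ?_, ?_, hp⟩ <;> rcases hs with rfl | rfl <;>
      rcases ht with rfl | rfl <;> omega

/-- A Robinson field has no nonzero period. -/
theorem eq_zero_of_period (F : RobinsonField out line crn) {v : ℤ × ℤ}
    (hl : ∀ z a b, line z a b → line (z + v) a b) (hc : ∀ z, crn z → crn (z + v)) : v = 0 := by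
  have hL : ∀ n z, Level line crn n z → Level line crn n (z + v) := by
    intro n
    induction n with
    | zero => exact hc
    | succ n ih =>
      intro z hz u w hf
      rw [add_right_comm]
      exact ⟨ih _ (hz u w hf).1, hl _ _ _ (hz u w hf).2⟩
  obtain ⟨n, hn⟩ : ∃ n : ℕ, |v.1| + |v.2| < 2 ^ n := by
    obtain ⟨n, hn⟩ := exists_nat_gt (|v.1| + |v.2|)
    exact ⟨n, hn.trans (by exact_mod_cast Nat.lt_two_pow_self)⟩
  obtain ⟨i, j, -, -, -, -, hz⟩ := F.covering n 0 _ _ IsFrame.std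
  have hz' := hL n _ hz
  have e : v = v.1 • ((1 : ℤ), (0 : ℤ)) + v.2 • ((0 : ℤ), (1 : ℤ)) := by ext <;> simp
  rw [e, ← add_assoc] at hz'
  have := abs_nonneg v.1
  have := abs_nonneg v.2
  have := F.separated n _ _ _ IsFrame.std v.1 v.2 (by omega) (by omega) hz hz'
  exact Prod.ext this.1 this.2

end RobinsonField

/-! ### Coordinates, isometries and points on the boundary of squares -/

@[simp] theorem pt_zero (x y : ℝ) : pt x y 0 = x := rfl

@[simp] theorem pt_one (x y : ℝ) : pt x y 1 = y := rfl

theorem pt_eta (p : Plane) : pt (p 0) (p 1) = p := by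
  ext i
  fin_cases i <;> rfl

theorem pt_inj {a b c d : ℝ} : pt a b = pt c d ↔ a = c ∧ b = d := by
  refine ⟨fun h => ⟨by simpa using congrArg (fun p : Plane => p 0) h,
    by simpa using congrArg (fun p : Plane => p 1) h⟩, fun h => by rw [h.1, h.2]⟩

/-- The points of the plane whose coordinates are multiples of `1 / 4`. -/
noncomputable def quarterPt (a : ℤ × ℤ) : Plane := pt (a.1 / 4) (a.2 / 4)

theorem quarterPt_injective : Function.Injective quarterPt := by
  intro a b h
  have := pt_inj.1 h
  ext
  · exact_mod_cast (div_left_inj' (by norm_num : (4 : ℝ) ≠ 0)).1 this.1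
  · exact_mod_cast (div_left_inj' (by norm_num : (4 : ℝ) ≠ 0)).1 this.2

/-- The isometry `g` maps the standard coordinate system to the one with origin `c` and
axes `u`, `w`. -/
def RealFrameAt (g : Plane ≃ᵢ Plane) (c u w : ℝ × ℝ) : Prop :=
  ∀ a b : ℝ, g (pt a b) = pt (c.1 + a * u.1 + b * w.1) (c.2 + a * u.2 + b * w.2)

/-- Every isometry of the plane is given by an orthonormal coordinate system. -/
theorem exists_realFrameAt (g : Plane ≃ᵢ Plane) : ∃ c u : ℝ × ℝ, ∃ s : ℝ, (s = 1 ∨ s = -1) ∧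
    u.1 ^ 2 + u.2 ^ 2 = 1 ∧ RealFrameAt g c u (-s * u.2, s * u.1) := by
  set L := g.toRealAffineIsometryEquiv.linearIsometryEquiv with hL
  have hg : ∀ x, g x = L x + g 0 := fun x => by
    have := g.toRealAffineIsometryEquiv.map_vadd (0 : Plane) x
    simpa using this
  have hu : inner ℝ (L (pt 1 0)) (L (pt 1 0)) = (1 : ℝ) := by
    rw [L.inner_map_map]; simp only [PiLp.inner_apply, Fin.sum_univ_two, pt_zero, pt_one]; simp
  have hw : inner ℝ (L (pt 0 1)) (L (pt 0 1)) = (1 : ℝ) := by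
    rw [L.inner_map_map]; simp only [PiLp.inner_apply, Fin.sum_univ_two, pt_zero, pt_one]; simp
  have huw : inner ℝ (L (pt 1 0)) (L (pt 0 1)) = (0 : ℝ) := by
    rw [L.inner_map_map]; simp only [PiLp.inner_apply, Fin.sum_univ_two, pt_zero, pt_one]; simp
  have key : ∀ a b : ℝ, g (pt a b) = a • L (pt 1 0) + b • L (pt 0 1) + g 0 := fun a b => by
    rw [hg, ← map_smul, ← map_smul, ← map_add]
    congr 2
    ext i
    fin_cases i <;> simp [pt]
  simp only [PiLp.inner_apply, Fin.sum_univ_two, RCLike.inner_apply, conj_trivial] at hu hw huw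
  set u := L (pt 1 0)
  set w := L (pt 0 1)
  -- The sign is the determinant of the orthonormal pair; its square is `1` by Lagrange's identity.
  refine ⟨(g 0 0, g 0 1), (u 0, u 1), u 0 * w 1 - u 1 * w 0, ?_, by simp only; linarith, ?_⟩
  · rw [← mul_self_eq_one_iff]
    linear_combination (w 0 * w 0 + w 1 * w 1) * hu + hw -
      (u 0 * w 0 + u 1 * w 1) * huw
  · intro a b
    rw [key, ← pt_eta (a • u + b • w + g 0), pt_inj]
    simp only [PiLp.add_apply, PiLp.smul_apply, smul_eq_mul]
    constructor
    · linear_combination b * u 0 * huw - b * w 0 * hu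
    · linear_combination b * u 1 * huw - b * w 1 * hu

/-- The isometry `g` maps the standard coordinate system to the one with origin `z` and
axes `u`, `w`. -/
def FrameAt (g : Plane ≃ᵢ Plane) (z u w : ℤ × ℤ) : Prop :=
  RealFrameAt g (z.1, z.2) (u.1, u.2) (w.1, w.2)

theorem FrameAt.map_quarterPt {g : Plane ≃ᵢ Plane} {z u w : ℤ × ℤ} (h : FrameAt g z u w)
    (a : ℤ × ℤ) : g (quarterPt a) = quarterPt (4 • z + a.1 • u + a.2 • w) := by
  rw [quarterPt, h, quarterPt, pt_inj]
  simp only [Prod.fst_add, Prod.snd_add, Prod.smul_fst, Prod.smul_snd, smul_eq_mul]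
  push_cast [nsmul_eq_mul]
  constructor <;> ring

/-- The midpoint of the edge in direction `a` of the unit square centred at `z`. -/
noncomputable def edgePt (z a : ℤ × ℤ) : Plane := quarterPt (4 • z + 2 • a)

/-- The point on the edge in direction `a` of the unit square centred at `z` that is displaced
from the midpoint by one quarter in direction `b`. -/
noncomputable def endPt (z a b : ℤ × ℤ) : Plane := quarterPt (4 • z + 2 • a + b)

/-- The vertex in direction `a + b` of the unit square centred at `z`. -/
noncomputable def vertexPt (z a b : ℤ × ℤ) : Plane := quarterPt (4 • z + 2 • a + 2 • b)

section points

variable {z z' a b a' b' : ℤ × ℤ}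

theorem edgePt_eq_iff (h : IsFrame a b) (h' : IsFrame a' b') :
    edgePt z a = edgePt z' a' ↔ (z' = z ∧ a' = a) ∨ (z' = z + a ∧ a' = -a) := by
  obtain ⟨z1, z2⟩ := z
  obtain ⟨y1, y2⟩ := z'
  rw [edgePt, edgePt, quarterPt_injective.eq_iff]
  obtain ⟨rfl | rfl, rfl | rfl⟩ | ⟨rfl | rfl, rfl | rfl⟩ := h.eq_or <;>
  obtain ⟨rfl | rfl, rfl | rfl⟩ | ⟨rfl | rfl, rfl | rfl⟩ := h'.eq_or <;>
  simp [Prod.ext_iff] <;> omega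

theorem endPt_eq_iff (h : IsFrame a b) (h' : IsFrame a' b') : endPt z a b = endPt z' a' b' ↔
    (z' = z ∧ a' = a ∧ b' = b) ∨ (z' = z + a ∧ a' = -a ∧ b' = b) := by
  obtain ⟨z1, z2⟩ := z
  obtain ⟨y1, y2⟩ := z'
  rw [endPt, endPt, quarterPt_injective.eq_iff]
  obtain ⟨rfl | rfl, rfl | rfl⟩ | ⟨rfl | rfl, rfl | rfl⟩ := h.eq_or <;>
  obtain ⟨rfl | rfl, rfl | rfl⟩ | ⟨rfl | rfl, rfl | rfl⟩ := h'.eq_or <;>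
  simp [Prod.ext_iff] <;> omega

theorem eq_of_vertexPt_eq (h : IsFrame a b) (h' : IsFrame a' b')
    (e : vertexPt z a b = vertexPt z' a' b') :
    z' = z ∨ z' = z + a ∨ z' = z + b ∨ z' = z + a + b := by
  obtain ⟨z1, z2⟩ := z
  obtain ⟨y1, y2⟩ := z'
  rw [vertexPt, vertexPt, quarterPt_injective.eq_iff] at e
  revert e
  obtain ⟨rfl | rfl, rfl | rfl⟩ | ⟨rfl | rfl, rfl | rfl⟩ := h.eq_or <;>
  obtain ⟨rfl | rfl, rfl | rfl⟩ | ⟨rfl | rfl, rfl | rfl⟩ := h'.eq_or <;>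
  simp [Prod.ext_iff] <;> omega

theorem edgePt_add_neg : edgePt (z + a) (-a) = edgePt z a := by
  rw [edgePt, edgePt]; congr 1; module

theorem endPt_add_neg : endPt (z + a) (-a) b = endPt z a b := by
  rw [endPt, endPt]; congr 1; module

theorem vertexPt_add_neg : vertexPt (z + a) (-a) b = vertexPt z a b := by
  rw [vertexPt, vertexPt]; congr 1; module

theorem vertexPt_comm : vertexPt z a b = vertexPt z b a := by
  rw [vertexPt, vertexPt]; congr 1; module

end points

/-! ### Robinson tiles in lattice position -/

/-- `t` is the copy of a cross tile at `z` whose elbow points in direction `u + w`. -/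
structure IsCrossAt (t : MarkedTile) (z u w : ℤ × ℤ) (isCornered : Prop) : Prop where
  bumps : ∀ x, x ∈ t.bumps ↔ ∃ a b, IsFrame a b ∧ x = edgePt z a
  nicks : ∀ x, x ∉ t.nicks
  lineEnds : ∀ x, x ∈ t.lineEnds ↔ x = endPt z u w ∨ x = endPt z w u
  cornered : ∀ x, x ∈ t.cornered ↔ isCornered ∧ ∃ a b, IsFrame a b ∧ x = vertexPt z a b
  cornerless : ∀ x, x ∈ t.cornerless ↔ ¬ isCornered ∧ ∃ a b, IsFrame a b ∧ x = vertexPt z a b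

/-- `t` is the copy of a passing tile at `z` whose bump is in direction `w`. -/
structure IsPassingAt (t : MarkedTile) (z u w : ℤ × ℤ) (along across : Prop) : Prop where
  bumps : ∀ x, x ∈ t.bumps ↔ x = edgePt z w
  nicks : ∀ x, x ∈ t.nicks ↔ ∃ a b, IsFrame a b ∧ a ≠ w ∧ x = edgePt z a
  lineEnds : ∀ x, x ∈ t.lineEnds ↔ (along ∧ (x = endPt z w u ∨ x = endPt z (-w) u)) ∨
    (across ∧ (x = endPt z u (-w) ∨ x = endPt z (-u) (-w)))
  cornered : ∀ x, x ∉ t.cornered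
  cornerless : ∀ x, x ∈ t.cornerless ↔ ∃ a b, IsFrame a b ∧ x = vertexPt z a b

section describe

variable {g : Plane ≃ᵢ Plane} {z u w : ℤ × ℤ}

theorem mem_image_squareVertices (hf : IsFrame u w) (h : FrameAt g z u w) (x : Plane) :
    x ∈ g '' squareVertices ↔ ∃ a b, IsFrame a b ∧ x = vertexPt z a b := by
  have e : ∀ i j : ℤ, g (pt (i / 2) (j / 2)) = vertexPt z (i • u) (j • w) := fun i j => by
    have : pt (i / 2 : ℝ) (j / 2) = quarterPt (2 * i, 2 * j) := by
      rw [quarterPt, pt_inj]; push_cast; constructor <;> ring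
    rw [this, h.map_quarterPt, vertexPt]
    congr 1
    module
  constructor
  · rintro ⟨p, ⟨h0, h1⟩, rfl⟩
    rw [← pt_eta p]
    have hs : ∀ r : ℝ, |r| = 1 / 2 → r = (1 : ℤ) / 2 ∨ r = (-1 : ℤ) / 2 := fun r hr => by
      rcases abs_eq (by norm_num) |>.1 hr with h | h
      · left; simp [h]
      · right; rw [h]; push_cast; ring
    rcases hs _ h0 with h0 | h0 <;> rcases hs _ h1 with h1 | h1 <;> rw [h0, h1, e]
    · exact ⟨_, _, by simpa using hf, rfl⟩
    · exact ⟨_, _, by simpa using hf.neg_right, rfl⟩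
    · exact ⟨_, _, by simpa using hf.neg_left, rfl⟩
    · exact ⟨_, _, by simpa using hf.neg_left.neg_right, rfl⟩
  · rintro ⟨a, b, hab, rfl⟩
    have hs : ∀ i j : ℤ, (i = 1 ∨ i = -1) → (j = 1 ∨ j = -1) →
        vertexPt z (i • u) (j • w) ∈ g '' squareVertices := fun i j hi hj => by
      refine ⟨_, ?_, e i j⟩
      rcases hi with rfl | rfl <;> rcases hj with rfl | rfl <;> simp [squareVertices, abs_div]
    have h1 := hs 1 1 (by simp) (by simp)
    have h2 := hs 1 (-1) (by simp) (by simp)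
    have h3 := hs (-1) 1 (by simp) (by simp)
    have h4 := hs (-1) (-1) (by simp) (by simp)
    simp only [one_smul, neg_smul] at h1 h2 h3 h4
    obtain ⟨rfl | rfl, rfl | rfl⟩ | ⟨rfl | rfl, rfl | rfl⟩ := hf.rel hab
    · exact h1
    · exact h2
    · exact h3
    · exact h4
    all_goals rw [vertexPt_comm]
    · exact h1
    · exact h3
    · exact h2
    · exact h4

theorem pt_eq_quarterPt (i j : ℤ) (x y : ℝ) (hx : x = i / 4) (hy : y = j / 4) :
    pt x y = quarterPt (i, j) := by rw [quarterPt, hx, hy]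

theorem FrameAt.map_pt (h : FrameAt g z u w) (i j : ℤ) {x y : ℝ} (hx : x = i / 4)
    (hy : y = j / 4) {p : ℤ × ℤ} (hp : 4 • z + i • u + j • w = p) :
    g (pt x y) = quarterPt p := by
  rw [pt_eq_quarterPt i j x y hx hy, h.map_quarterPt, ← hp]

theorem isCrossAt_map (hf : IsFrame u w) (h : FrameAt g z u w) (c : Bool) :
    IsCrossAt ((crossTile c).map g) z u w (c = true) := by
  have e1 : g (pt 0 (1 / 2)) = edgePt z w :=
    h.map_pt 0 2 (by norm_num) (by norm_num) (by module)
  have e2 : g (pt (1 / 2) 0) = edgePt z u :=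
    h.map_pt 2 0 (by norm_num) (by norm_num) (by module)
  have e3 : g (pt 0 (-1 / 2)) = edgePt z (-w) :=
    h.map_pt 0 (-2) (by norm_num) (by norm_num) (by module)
  have e4 : g (pt (-1 / 2) 0) = edgePt z (-u) :=
    h.map_pt (-2) 0 (by norm_num) (by norm_num) (by module)
  have e5 : g (pt (1 / 4) (1 / 2)) = endPt z w u :=
    h.map_pt 1 2 (by norm_num) (by norm_num) (by module)
  have e6 : g (pt (1 / 2) (1 / 4)) = endPt z u w :=
    h.map_pt 2 1 (by norm_num) (by norm_num) (by module)
  constructor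
  · intro x
    simp only [MarkedTile.map, crossTile, Set.image_insert_eq, Set.image_singleton, e1, e2, e3, e4,
      Set.mem_insert_iff, Set.mem_singleton_iff]
    constructor
    · rintro (rfl | rfl | rfl | rfl)
      exacts [⟨_, _, hf.symm, rfl⟩, ⟨_, _, hf, rfl⟩, ⟨_, _, hf.symm.neg_left, rfl⟩,
        ⟨_, _, hf.neg_left, rfl⟩]
    · rintro ⟨a, b, hab, rfl⟩
      obtain ⟨rfl | rfl, -⟩ | ⟨rfl | rfl, -⟩ := hf.rel hab <;> simp
  · simp [MarkedTile.map, crossTile]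
  · intro x
    simp only [MarkedTile.map, crossTile, Set.image_insert_eq, Set.image_singleton, e5, e6,
      Set.mem_insert_iff, Set.mem_singleton_iff]
    tauto
  · intro x
    rw [← mem_image_squareVertices hf h]
    cases c <;> simp [MarkedTile.map, crossTile]
  · intro x
    rw [← mem_image_squareVertices hf h]
    cases c <;> simp [MarkedTile.map, crossTile]

theorem isPassingAt_map (hf : IsFrame u w) (h : FrameAt g z u w) (al ac : Bool) :
    IsPassingAt ((passingTile al ac).map g) z u w (al = true) (ac = true) := by
  have e1 : g (pt 0 (1 / 2)) = edgePt z w :=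
    h.map_pt 0 2 (by norm_num) (by norm_num) (by module)
  have e2 : g (pt (1 / 2) 0) = edgePt z u :=
    h.map_pt 2 0 (by norm_num) (by norm_num) (by module)
  have e3 : g (pt 0 (-1 / 2)) = edgePt z (-w) :=
    h.map_pt 0 (-2) (by norm_num) (by norm_num) (by module)
  have e4 : g (pt (-1 / 2) 0) = edgePt z (-u) :=
    h.map_pt (-2) 0 (by norm_num) (by norm_num) (by module)
  have e5 : g (pt (1 / 4) (1 / 2)) = endPt z w u :=
    h.map_pt 1 2 (by norm_num) (by norm_num) (by module)
  have e6 : g (pt (1 / 4) (-1 / 2)) = endPt z (-w) u :=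
    h.map_pt 1 (-2) (by norm_num) (by norm_num) (by module)
  have e7 : g (pt (1 / 2) (-1 / 4)) = endPt z u (-w) :=
    h.map_pt 2 (-1) (by norm_num) (by norm_num) (by module)
  have e8 : g (pt (-1 / 2) (-1 / 4)) = endPt z (-u) (-w) :=
    h.map_pt (-2) (-1) (by norm_num) (by norm_num) (by module)
  have hne := hf.ne_all
  constructor
  · intro x
    simp only [MarkedTile.map, passingTile, Set.image_singleton, e1, Set.mem_singleton_iff]
  · intro x
    simp only [MarkedTile.map, passingTile, Set.image_insert_eq, Set.image_singleton, e2, e3, e4,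
      Set.mem_insert_iff, Set.mem_singleton_iff]
    constructor
    · rintro (rfl | rfl | rfl)
      exacts [⟨_, _, hf, hne.1, rfl⟩,
        ⟨_, _, hf.symm.neg_left, hne.2.2.2.2.2.2.2.1, rfl⟩,
        ⟨_, _, hf.neg_left, hf.neg_left.ne_all.1, rfl⟩]
    · rintro ⟨a, b, hab, ha, rfl⟩
      obtain ⟨rfl | rfl, -⟩ | ⟨rfl | rfl, -⟩ := hf.rel hab <;> simp_all
  · intro x
    cases al <;> cases ac <;>
    simp only [MarkedTile.map, passingTile, Set.image_insert_eq, Set.image_singleton, e5, e6, e7,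
      e8, Set.mem_insert_iff, Set.mem_singleton_iff, Set.image_union, if_true, if_false,
      Set.image_empty, Set.mem_union, Set.mem_empty_iff_false, true_and, false_and,
      false_or, or_false, Bool.false_eq_true]
  · simp [MarkedTile.map, passingTile]
  · exact fun x => mem_image_squareVertices hf h x

end describe

/-- The closed unit square centred at `z`. -/
def latticeSquare (z : ℤ × ℤ) : Set Plane := {x | |x 0 - z.1| ≤ 1 / 2 ∧ |x 1 - z.2| ≤ 1 / 2}

/-- `t` is a copy of a Robinson tile at `z`. -/
structure TileAt (t : MarkedTile) (z : ℤ × ℤ) : Prop where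
  region : t.region = latticeSquare z
  marked : ∃ u w, IsFrame u w ∧ ((∃ c, IsCrossAt t z u w c) ∨ ∃ al ac, IsPassingAt t z u w al ac)

/-- `t` is the image of a Robinson tile under an isometry that maps the coordinate axes to lines
parallel to the axes and the origin to `z`. -/
def Placed (t : MarkedTile) (z : ℤ × ℤ) : Prop :=
  ∃ p ∈ robinsonTiles, ∃ g u w, IsFrame u w ∧ FrameAt g z u w ∧ t = p.map g

theorem image_unitSquare {g : Plane ≃ᵢ Plane} {z u w : ℤ × ℤ} (hf : IsFrame u w)
    (h : FrameAt g z u w) : g '' unitSquare = latticeSquare z := by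
  ext x
  constructor
  · rintro ⟨p, ⟨h0, h1⟩, rfl⟩
    rw [← pt_eta p, h]
    obtain ⟨rfl | rfl, rfl | rfl⟩ | ⟨rfl | rfl, rfl | rfl⟩ := hf.eq_or <;>
      simp [latticeSquare] at h0 h1 ⊢ <;> exact ⟨by assumption, by assumption⟩
  · rintro ⟨h0, h1⟩
    refine ⟨pt ((x 0 - z.1) * u.1 + (x 1 - z.2) * u.2) ((x 0 - z.1) * w.1 + (x 1 - z.2) * w.2),
      ?_, ?_⟩
    · obtain ⟨rfl | rfl, rfl | rfl⟩ | ⟨rfl | rfl, rfl | rfl⟩ := hf.eq_or <;>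
        simp [unitSquare, abs_sub_comm] at h0 h1 ⊢ <;> exact ⟨by assumption, by assumption⟩
    · rw [h, ← pt_eta x, pt_inj]
      obtain ⟨rfl | rfl, rfl | rfl⟩ | ⟨rfl | rfl, rfl | rfl⟩ := hf.eq_or <;> simp

theorem mem_robinsonTiles {p : MarkedTile} :
    p ∈ robinsonTiles ↔ (∃ c, p = crossTile c) ∨ ∃ al ac, p = passingTile al ac := by
  simp only [robinsonTiles, Set.mem_insert_iff, Set.mem_singleton_iff, Bool.exists_bool]
  tauto

theorem Placed.tileAt {t : MarkedTile} {z : ℤ × ℤ} (h : Placed t z) : TileAt t z := by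
  obtain ⟨p, hp, g, u, w, hf, hg, rfl⟩ := h
  obtain ⟨c, rfl⟩ | ⟨al, ac, rfl⟩ := mem_robinsonTiles.1 hp
  · exact ⟨image_unitSquare hf hg, u, w, hf, Or.inl ⟨_, isCrossAt_map hf hg c⟩⟩
  · exact ⟨image_unitSquare hf hg, u, w, hf, Or.inr ⟨_, _, isPassingAt_map hf hg al ac⟩⟩

theorem pt_mem_latticeSquare {z : ℤ × ℤ} {x y : ℝ} :
    pt x y ∈ latticeSquare z ↔ |x - z.1| ≤ 1 / 2 ∧ |y - z.2| ≤ 1 / 2 := Iff.rfl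

theorem latticeSquare_subset {z : ℤ × ℤ} {x y : ℝ}
    (h : latticeSquare z ⊆ {p | |p 0 - x| ≤ 1 / 2 ∧ |p 1 - y| ≤ 1 / 2}) :
    x = z.1 ∧ y = z.2 := by
  have h1 : pt (z.1 + 1 / 2) (z.2 + 1 / 2) ∈ latticeSquare z := by
    rw [pt_mem_latticeSquare]; norm_num
  have h2 : pt (z.1 - 1 / 2) (z.2 - 1 / 2) ∈ latticeSquare z := by
    rw [pt_mem_latticeSquare]; norm_num
  have h3 := h h1
  have h4 := h h2
  simp only [Set.mem_ofPred_eq, pt_zero, pt_one, abs_le] at h3 h4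
  constructor <;> linarith

theorem latticeSquare_injective : Function.Injective latticeSquare := fun z z' h => by
  have := latticeSquare_subset (x := z'.1) (y := z'.2) h.subset
  exact Prod.ext (by exact_mod_cast this.1.symm) (by exact_mod_cast this.2.symm)

namespace TileAt

variable {t t' : MarkedTile} {z z' a b a' b' : ℤ × ℤ}

theorem eq (h : TileAt t z) (h' : TileAt t z') : z = z' :=
  latticeSquare_injective (h.region.symm.trans h'.region)

theorem exists_of_mem_bumps (h : TileAt t z) {x : Plane} (hx : x ∈ t.bumps) :
    ∃ a b, IsFrame a b ∧ x = edgePt z a := by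
  obtain ⟨-, u, w, hf, ⟨c, hc⟩ | ⟨al, ac, hc⟩⟩ := h
  · exact (hc.bumps x).1 hx
  · exact ⟨_, _, hf.symm, (hc.bumps x).1 hx⟩

theorem exists_of_mem_nicks (h : TileAt t z) {x : Plane} (hx : x ∈ t.nicks) :
    ∃ a b, IsFrame a b ∧ x = edgePt z a := by
  obtain ⟨-, u, w, hf, ⟨c, hc⟩ | ⟨al, ac, hc⟩⟩ := h
  · exact absurd hx (hc.nicks x)
  · obtain ⟨a, b, hab, -, hx⟩ := (hc.nicks x).1 hx
    exact ⟨a, b, hab, hx⟩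

theorem edgePt_inj (h : IsFrame a b) (h' : IsFrame a' b') :
    edgePt z a = edgePt z a' ↔ a = a' := by
  refine ⟨fun e => ?_, fun e => by rw [e]⟩
  rcases (edgePt_eq_iff h h').1 e with h1 | h1
  · exact h1.2.symm
  · have : a = 0 := by simpa using h1.1.symm
    rw [this] at h
    exact absurd h.1 (by norm_num)

theorem endPt_inj (h : IsFrame a b) (h' : IsFrame a' b') :
    endPt z a b = endPt z a' b' ↔ a = a' ∧ b = b' := by
  refine ⟨fun e => ?_, fun e => by rw [e.1, e.2]⟩
  rcases (endPt_eq_iff h h').1 e with h1 | h1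
  · exact ⟨h1.2.1.symm, h1.2.2.symm⟩
  · have : a = 0 := by simpa using h1.1.symm
    rw [this] at h
    exact absurd h.1 (by norm_num)

theorem mem_nicks_iff (h : TileAt t z) (hab : IsFrame a b) :
    edgePt z a ∈ t.nicks ↔ edgePt z a ∉ t.bumps := by
  obtain ⟨-, u, w, hf, ⟨c, hc⟩ | ⟨al, ac, hc⟩⟩ := h
  · rw [hc.bumps]
    exact iff_of_false (hc.nicks _) (not_not.2 ⟨a, b, hab, rfl⟩)
  · rw [hc.bumps, hc.nicks, edgePt_inj hab hf.symm]
    constructor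
    · rintro ⟨a', b', hab', hne, e⟩
      rwa [(edgePt_inj hab hab').1 e]
    · exact fun hne => ⟨a, b, hab, hne, rfl⟩

theorem exists_of_mem_lineEnds (h : TileAt t z) {x : Plane} (hx : x ∈ t.lineEnds) :
    ∃ a b, IsFrame a b ∧ x = endPt z a b := by
  obtain ⟨-, u, w, hf, ⟨c, hc⟩ | ⟨al, ac, hc⟩⟩ := h
  · rcases (hc.lineEnds x).1 hx with rfl | rfl
    exacts [⟨_, _, hf, rfl⟩, ⟨_, _, hf.symm, rfl⟩]
  · rcases (hc.lineEnds x).1 hx with ⟨-, rfl | rfl⟩ | ⟨-, rfl | rfl⟩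
    exacts [⟨_, _, hf.symm, rfl⟩, ⟨_, _, hf.symm.neg_left, rfl⟩, ⟨_, _, hf.neg_right, rfl⟩,
      ⟨_, _, hf.neg_left.neg_right, rfl⟩]

theorem exists_of_mem_vertices (h : TileAt t z) {x : Plane} (hx : x ∈ t.cornered ∪ t.cornerless) :
    ∃ a b, IsFrame a b ∧ x = vertexPt z a b := by
  obtain ⟨-, u, w, hf, ⟨c, hc⟩ | ⟨al, ac, hc⟩⟩ := h
  · rcases hx with hx | hx
    exacts [((hc.cornered x).1 hx).2, ((hc.cornerless x).1 hx).2]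
  · rcases hx with hx | hx
    exacts [absurd hx (hc.cornered x), (hc.cornerless x).1 hx]

theorem vertexPt_mem (h : TileAt t z) (hab : IsFrame a b) :
    vertexPt z a b ∈ t.cornered ∪ t.cornerless := by
  obtain ⟨-, u, w, hf, ⟨c, hc⟩ | ⟨al, ac, hc⟩⟩ := h
  · by_cases h : c
    · exact Or.inl ((hc.cornered _).2 ⟨h, a, b, hab, rfl⟩)
    · exact Or.inr ((hc.cornerless _).2 ⟨h, a, b, hab, rfl⟩)
  · exact Or.inr ((hc.cornerless _).2 ⟨a, b, hab, rfl⟩)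

theorem vertexPt_mem_cornered (h : TileAt t z) (hab : IsFrame a b) {x : Plane}
    (hx : x ∈ t.cornered) : vertexPt z a b ∈ t.cornered := by
  obtain ⟨-, u, w, hf, ⟨c, hc⟩ | ⟨al, ac, hc⟩⟩ := h
  · exact (hc.cornered _).2 ⟨((hc.cornered x).1 hx).1, a, b, hab, rfl⟩
  · exact absurd hx (hc.cornered x)

theorem edgePt_mem_bumps_of_cornered (h : TileAt t z) (hab : IsFrame a b) {x : Plane}
    (hx : x ∈ t.cornered) : edgePt z a ∈ t.bumps := by
  obtain ⟨-, u, w, hf, ⟨c, hc⟩ | ⟨al, ac, hc⟩⟩ := h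
  · exact (hc.bumps _).2 ⟨a, b, hab, rfl⟩
  · exact absurd hx (hc.cornered x)

theorem rule (h : TileAt t z) : ∃ u w, IsFrame u w ∧
    (((∀ a b, IsFrame a b → edgePt z a ∈ t.bumps) ∧
      ∀ a b, IsFrame a b → (endPt z a b ∈ t.lineEnds ↔ (a = u ∧ b = w) ∨ (a = w ∧ b = u))) ∨
    ((∀ a b, IsFrame a b → (edgePt z a ∈ t.bumps ↔ a = w)) ∧ ∃ al ac : Prop,
      ∀ a b, IsFrame a b → (endPt z a b ∈ t.lineEnds ↔
        (al ∧ (a = w ∨ a = -w) ∧ b = u) ∨ (ac ∧ (a = u ∨ a = -u) ∧ b = -w)))) := by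
  obtain ⟨-, u, w, hf, ⟨c, hc⟩ | ⟨al, ac, hc⟩⟩ := h
  · refine ⟨u, w, hf, Or.inl ⟨fun a b hab => (hc.bumps _).2 ⟨a, b, hab, rfl⟩, fun a b hab => ?_⟩⟩
    rw [hc.lineEnds, endPt_inj hab hf, endPt_inj hab hf.symm]
  · refine ⟨u, w, hf, Or.inr ⟨fun a b hab => ?_, al, ac, fun a b hab => ?_⟩⟩
    · rw [hc.bumps, edgePt_inj hab hf.symm]
    · rw [hc.lineEnds, endPt_inj hab hf.symm, endPt_inj hab hf.symm.neg_left,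
        endPt_inj hab hf.neg_right, endPt_inj hab hf.neg_left.neg_right]
      tauto

end TileAt

/-! ### Robinson's rules for lattice tessellations -/

/-- A tessellation that consists of one Robinson tile at each lattice point satisfies Robinson's
rules. -/
theorem IsTessellation.robinsonField {P T : Set MarkedTile} (hT : IsTessellation P T)
    {t : ℤ × ℤ → MarkedTile} (ht : ∀ z, TileAt (t z) z) (hrange : T = Set.range t) :
    RobinsonField (fun z a => edgePt z a ∈ (t z).bumps) (fun z a b => endPt z a b ∈ (t z).lineEnds)
      (fun z => vertexPt z (1, 0) (0, 1) ∈ (t z).cornered) := by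
  have hm : ∀ z, t z ∈ T := fun z => by rw [hrange]; exact ⟨z, rfl⟩
  have hm' : ∀ s ∈ T, ∃ z, s = t z := fun s hs => by
    rw [hrange] at hs
    obtain ⟨z, rfl⟩ := hs
    exact ⟨z, rfl⟩
  have hne : ∀ {z u w}, IsFrame u w → z ≠ z + u := fun {z u w} hf h => by
    have : u = 0 := by simpa using h.symm
    rw [this] at hf
    exact absurd hf.1 (by norm_num)
  -- A tile is cornered at all its vertices or at none, so the vertex chosen to define `crn` is
  -- immaterial.
  have hcrn : ∀ z a b, IsFrame a b → ((vertexPt z (1, 0) (0, 1) ∈ (t z).cornered) ↔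
      vertexPt z a b ∈ (t z).cornered) := fun z a b hab =>
    ⟨(ht z).vertexPt_mem_cornered hab, (ht z).vertexPt_mem_cornered IsFrame.std⟩
  have hline : ∀ z u w, IsFrame u w → endPt z u w ∈ (t z).lineEnds →
      endPt (z + u) (-u) w ∈ (t (z + u)).lineEnds := by
    intro z u w hf h
    obtain ⟨s, hs, hne, hx⟩ := hT.line_fits _ (hm z) _ h
    obtain ⟨z', rfl⟩ := hm' s hs
    obtain ⟨a, b, hab, e⟩ := (ht z').exists_of_mem_lineEnds hx
    obtain ⟨rfl, -⟩ | ⟨rfl, -⟩ := (endPt_eq_iff hf hab).1 e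
    · exact absurd rfl hne
    · rwa [endPt_add_neg]
  refine ⟨?_, ?_, fun z => (ht z).rule, fun z a b hz hab =>
    (ht z).edgePt_mem_bumps_of_cornered hab hz, ?_, ?_⟩
  · intro z u w hf
    constructor
    · intro h1 h2
      obtain ⟨s, hs, hx⟩ := hT.bump_fits _ (hm z) _ h2
      obtain ⟨z', rfl⟩ := hm' s hs
      obtain ⟨a, b, hab, e⟩ := (ht z').exists_of_mem_nicks hx
      obtain ⟨rfl, -⟩ | ⟨rfl, -⟩ := (edgePt_eq_iff hf hab).1 e
      · exact (ht z').mem_nicks_iff hf |>.1 hx h2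
      · rw [← edgePt_add_neg] at hx
        exact (ht _).mem_nicks_iff hf.neg_left |>.1 hx h1
    · intro h1
      rw [← (ht z).mem_nicks_iff hf] at h1
      obtain ⟨s, hs, hx⟩ := hT.nick_fits _ (hm z) _ h1
      obtain ⟨z', rfl⟩ := hm' s hs
      obtain ⟨a, b, hab, e⟩ := (ht z').exists_of_mem_bumps hx
      obtain ⟨rfl, -⟩ | ⟨rfl, -⟩ := (edgePt_eq_iff hf hab).1 e
      · exact absurd hx ((ht z').mem_nicks_iff hf |>.1 h1)
      · rwa [edgePt_add_neg]
  · intro z u w hf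
    refine ⟨fun h => ?_, hline z u w hf⟩
    have := hline _ _ _ hf.neg_left h
    rwa [neg_neg, add_neg_cancel_right] at this
  · intro z u w hf
    obtain ⟨s, ⟨hs, hx⟩, -⟩ := hT.corner_fits _ (hm z) _ ((ht z).vertexPt_mem hf)
    obtain ⟨z', rfl⟩ := hm' s hs
    obtain ⟨a, b, hab, e⟩ := (ht z').exists_of_mem_vertices (Or.inl hx)
    rw [e, ← hcrn _ _ _ hab] at hx
    obtain rfl | rfl | rfl | rfl := eq_of_vertexPt_eq hf hab e
    exacts [Or.inl hx, Or.inr (Or.inl hx), Or.inr (Or.inr (Or.inl hx)),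
      Or.inr (Or.inr (Or.inr hx))]
  · intro z u w hf h
    rw [hcrn z u w hf] at h
    have huniq : ∀ z', vertexPt z u w ∈ (t z').cornered → z' = z := fun z' h' => by
      have e : t z' = t z := (hT.corner_fits _ (hm z) _ ((ht z).vertexPt_mem hf)).unique
        ⟨hm _, h'⟩ ⟨hm _, h⟩
      exact (ht z').eq (e ▸ ht z)
    constructor <;> intro h'
    · rw [hcrn _ _ _ hf.neg_left, vertexPt_add_neg] at h'
      exact hne hf (huniq _ h').symm
    · rw [hcrn _ _ _ hf.neg_left.neg_right, vertexPt_comm, vertexPt_add_neg, vertexPt_comm,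
        vertexPt_add_neg] at h'
      have h1 := huniq _ h'
      have := IsFrame.coords_eq_zero hf (i := 1) (j := 1) (by
        simpa [add_assoc] using h1)
      omega

theorem MarkedTile.map_map (g g' : Plane ≃ᵢ Plane) (t : MarkedTile) :
    (t.map g).map g' = t.map (g.trans g') := by
  simp only [MarkedTile.map, Set.image_image]
  rfl

theorem MarkedTile.map_refl (t : MarkedTile) : t.map (IsometryEquiv.refl Plane) = t := by
  ext1 <;> exact Set.image_id _

theorem IsTessellation.map {P T : Set MarkedTile} (hT : IsTessellation P T) (g : Plane ≃ᵢ Plane) :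
    IsTessellation P (MarkedTile.map g '' T) := by
  constructor
  · rintro _ ⟨t, ht, rfl⟩
    obtain ⟨p, hp, g', rfl⟩ := hT.copies t ht
    exact ⟨p, hp, _, MarkedTile.map_map _ _ _⟩
  · intro x
    obtain ⟨t, ht, hx⟩ := hT.covers (g.symm x)
    exact ⟨_, ⟨t, ht, rfl⟩, _, hx, by simp⟩
  · rintro _ ⟨t, ht, rfl⟩ _ ⟨t', ht', rfl⟩ hne
    have := hT.no_overlap t ht t' ht' fun h => hne (by rw [h])
    change Disjoint (interior (g.toHomeomorph '' _)) (interior (g.toHomeomorph '' _))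
    rw [← Homeomorph.image_interior, ← Homeomorph.image_interior]
    exact (Set.disjoint_image_iff g.injective).2 this
  · rintro _ ⟨t, ht, rfl⟩ _ ⟨x, hx, rfl⟩
    obtain ⟨t', ht', hx'⟩ := hT.bump_fits t ht x hx
    exact ⟨_, ⟨t', ht', rfl⟩, x, hx', rfl⟩
  · rintro _ ⟨t, ht, rfl⟩ _ ⟨x, hx, rfl⟩
    obtain ⟨t', ht', hx'⟩ := hT.nick_fits t ht x hx
    exact ⟨_, ⟨t', ht', rfl⟩, x, hx', rfl⟩
  · rintro _ ⟨t, ht, rfl⟩ _ ⟨x, hx, rfl⟩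
    obtain ⟨t', ht', hne, hx'⟩ := hT.line_fits t ht x hx
    refine ⟨_, ⟨t', ht', rfl⟩, fun h => hne ?_, x, hx', rfl⟩
    have := congrArg (MarkedTile.map g.symm) h
    simpa only [MarkedTile.map_map, show g.trans g.symm = IsometryEquiv.refl Plane from
      IsometryEquiv.ext g.symm_apply_apply, MarkedTile.map_refl] using this
  · rintro _ ⟨t, ht, rfl⟩ x hx
    obtain ⟨y, hy, rfl⟩ : ∃ y ∈ t.cornered ∪ t.cornerless, g y = x := by
      rcases hx with ⟨y, hy, rfl⟩ | ⟨y, hy, rfl⟩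
      exacts [⟨y, Or.inl hy, rfl⟩, ⟨y, Or.inr hy, rfl⟩]
    obtain ⟨t', ⟨ht', hy'⟩, hu⟩ := hT.corner_fits t ht y hy
    refine ⟨_, ⟨⟨t', ht', rfl⟩, y, hy', rfl⟩, ?_⟩
    rintro _ ⟨⟨s, hs, rfl⟩, y', hy', e⟩
    rw [g.injective e] at hy'
    rw [hu s ⟨hs, hy'⟩]

/-! ### Every tessellation is congruent to a lattice one -/

theorem isOpen_openSquare (x y : ℝ) : IsOpen {p : Plane | |p 0 - x| < 1 / 2 ∧ |p 1 - y| < 1 / 2} :=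
  (isOpen_lt (f := fun p : Plane => |p 0 - x|) (by fun_prop) continuous_const).inter
    (isOpen_lt (f := fun p : Plane => |p 1 - y|) (by fun_prop) continuous_const)

theorem region_of_mem {p : MarkedTile} (hp : p ∈ robinsonTiles) : p.region = unitSquare := by
  obtain ⟨c, rfl⟩ | ⟨al, ac, rfl⟩ := mem_robinsonTiles.1 hp <;> rfl

theorem map_mem_interior {p : MarkedTile} (hp : p ∈ robinsonTiles) (g : Plane ≃ᵢ Plane) {a b : ℝ}
    (ha : |a| < 1 / 2) (hb : |b| < 1 / 2) : g (pt a b) ∈ interior (p.map g).region := by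
  change _ ∈ interior (g.toHomeomorph '' p.region)
  rw [← Homeomorph.image_interior, region_of_mem hp]
  refine ⟨_, ?_, rfl⟩
  refine mem_interior.2 ⟨_, fun q hq => ?_, isOpen_openSquare 0 0, by
    simp only [sub_zero]; exact ⟨ha, hb⟩⟩
  simp only [sub_zero] at hq
  exact ⟨hq.1.le, hq.2.le⟩

theorem mem_interior_latticeSquare {z : ℤ × ℤ} {a b : ℝ} (ha : |a - z.1| < 1 / 2)
    (hb : |b - z.2| < 1 / 2) : pt a b ∈ interior (latticeSquare z) :=
  mem_interior.2 ⟨_, fun _ hq => ⟨hq.1.le, hq.2.le⟩, isOpen_openSquare z.1 z.2, ha, hb⟩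

theorem exists_of_mem_bumps_union_nicks {p : MarkedTile} (hp : p ∈ robinsonTiles) {x : Plane}
    (hx : x ∈ p.bumps ∪ p.nicks) : ∃ e e' : ℤ × ℤ, IsFrame e e' ∧ x = pt (e.1 / 2) (e.2 / 2) := by
  have h1 : ∃ e e' : ℤ × ℤ, IsFrame e e' ∧ pt 0 (1 / 2) = pt (e.1 / 2) (e.2 / 2) :=
    ⟨_, _, IsFrame.std.symm, by simp⟩
  have h2 : ∃ e e' : ℤ × ℤ, IsFrame e e' ∧ pt (1 / 2) 0 = pt (e.1 / 2) (e.2 / 2) :=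
    ⟨_, _, IsFrame.std, by simp⟩
  have h3 : ∃ e e' : ℤ × ℤ, IsFrame e e' ∧ pt 0 (-1 / 2) = pt (e.1 / 2) (e.2 / 2) :=
    ⟨_, _, IsFrame.std.symm.neg_left, by simp⟩
  have h4 : ∃ e e' : ℤ × ℤ, IsFrame e e' ∧ pt (-1 / 2) 0 = pt (e.1 / 2) (e.2 / 2) :=
    ⟨_, _, IsFrame.std.neg_left, by simp⟩
  obtain ⟨c, rfl⟩ | ⟨al, ac, rfl⟩ := mem_robinsonTiles.1 hp
  · rcases hx with (rfl | rfl | rfl | rfl) | hx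
    exacts [h1, h2, h3, h4, absurd hx (Set.notMem_empty x)]
  · rcases hx with rfl | rfl | rfl | rfl
    exacts [h1, h2, h3, h4]

/-- Moving from `e / 2` by `-(e + f) / 5` lowers the coordinate along `e` by `(1 + e·f) / 5`, which
is positive and at most `2 / 5`, and changes the other one by at most `1 / 5`. Any positive constant
below `1 / 2` could replace `1 / 5`. -/
theorem shifted_mem {e e' : ℤ × ℤ} {f : ℝ × ℝ} (he : IsFrame e e')
    (h : (e.1 : ℝ) ^ 2 + (e.2 : ℝ) ^ 2 = 1 ∧ f.1 ^ 2 + f.2 ^ 2 = 1)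
    (hne : e.1 * f.1 + e.2 * f.2 ≠ -1) :
    |e.1 / 2 - (e.1 + f.1) / 5| < 1 / 2 ∧ |e.2 / 2 - (e.2 + f.2) / 5| < 1 / 2 := by
  have h1 : -1 < e.1 * f.1 + e.2 * f.2 := by
    refine lt_of_le_of_ne ?_ hne.symm
    nlinarith [sq_nonneg (e.1 + f.1), sq_nonneg (e.2 + f.2)]
  have h2 : -1 ≤ f.1 ∧ f.1 ≤ 1 := by
    constructor <;> nlinarith [sq_nonneg f.2, sq_nonneg (f.1 + 1), sq_nonneg (f.1 - 1)]
  have h3 : -1 ≤ f.2 ∧ f.2 ≤ 1 := by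
    constructor <;> nlinarith [sq_nonneg f.1, sq_nonneg (f.2 + 1), sq_nonneg (f.2 - 1)]
  rw [abs_lt, abs_lt]
  obtain ⟨rfl | rfl, -⟩ | ⟨rfl | rfl, -⟩ := he.eq_or <;> push_cast at h1 ⊢ <;>
    refine ⟨⟨?_, ?_⟩, ?_, ?_⟩ <;> linarith

/-- If two tiles do not overlap and share the midpoint of an edge, then they share the edge. -/
theorem placed_of_edgePt_mem {t t' p : MarkedTile} {g : Plane ≃ᵢ Plane} {z a b : ℤ × ℤ}
    (ht : TileAt t z) (hp : p ∈ robinsonTiles) (ht' : t' = p.map g)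
    (hd : Disjoint (interior t.region) (interior t'.region)) (hab : IsFrame a b)
    (hx : edgePt z a ∈ t'.bumps ∪ t'.nicks) : Placed t' (z + a) := by
  obtain ⟨e, e', he, hx⟩ : ∃ e e' : ℤ × ℤ, IsFrame e e' ∧
      edgePt z a = g (pt (e.1 / 2) (e.2 / 2)) := by
    rw [ht'] at hx
    obtain ⟨x, hx, hx'⟩ : ∃ x ∈ p.bumps ∪ p.nicks, g x = edgePt z a := by
      rcases hx with ⟨x, hx, hx'⟩ | ⟨x, hx, hx'⟩
      exacts [⟨x, Or.inl hx, hx'⟩, ⟨x, Or.inr hx, hx'⟩]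
    obtain ⟨e, e', he, rfl⟩ := exists_of_mem_bumps_union_nicks hp hx
    exact ⟨e, e', he, hx'.symm⟩
  obtain ⟨c, u, s, hs, hu, hg⟩ := exists_realFrameAt g
  obtain ⟨σ, hσ, rfl⟩ : ∃ σ : ℤ, σ ^ 2 = 1 ∧ s = σ := by
    rcases hs with rfl | rfl
    exacts [⟨1, by norm_num, by simp⟩, ⟨-1, by norm_num, by simp⟩]
  have hσ' : (σ : ℝ) ^ 2 = 1 := by exact_mod_cast hσ
  have ha1 : (a.1 : ℝ) ^ 2 + (a.2 : ℝ) ^ 2 = 1 := by exact_mod_cast hab.1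
  have he1 : (e.1 : ℝ) ^ 2 + (e.2 : ℝ) ^ 2 = 1 := by exact_mod_cast he.1
  rw [hg, edgePt, quarterPt, pt_inj] at hx
  simp only [Prod.fst_add, Prod.snd_add, Prod.smul_fst, Prod.smul_snd] at hx
  push_cast [nsmul_eq_mul] at hx
  obtain ⟨hx1, hx2⟩ := hx
  set d : ℝ × ℝ := (e.1 * u.1 - e.2 * σ * u.2, e.1 * u.2 + e.2 * σ * u.1) with hdd
  have hd1 : d.1 ^ 2 + d.2 ^ 2 = 1 := by
    simp only [hdd]
    linear_combination (e.1 ^ 2 + e.2 ^ 2 * σ ^ 2) * hu + he1 + e.2 ^ 2 * hσ'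
  have hc1 : c.1 = z.1 + a.1 / 2 - d.1 / 2 := by simp only [hdd]; linarith
  have hc2 : c.2 = z.2 + a.2 / 2 - d.2 / 2 := by simp only [hdd]; linarith
  -- Here `a` and `d` are the outer unit normals of the two squares at the common midpoint. Unless
  -- they are opposite, moving by `-(a + d) / 5` leads into both interiors.
  have hdot : a.1 * d.1 + a.2 * d.2 = -1 := by
    by_contra hne
    have h1 := shifted_mem hab ⟨ha1, hd1⟩ hne
    have h2 := shifted_mem he (f := (a.1 * u.1 + a.2 * u.2, a.1 * (-σ * u.2) + a.2 * (σ * u.1)))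
      ⟨he1, by
        linear_combination (a.2 * u.1 - a.1 * u.2) ^ 2 * hσ' +
          (a.1 ^ 2 + a.2 ^ 2) * hu + ha1⟩
      fun h => hne (by simp only [hdd]; linear_combination h)
    have h3 := map_mem_interior hp g h2.1 h2.2
    rw [hg, ← ht'] at h3
    refine Set.disjoint_left.1 hd ?_ h3
    rw [ht.region]
    refine mem_interior_latticeSquare ?_ ?_
    · convert h1.1 using 2
      simp only [hdd] at hc1 ⊢
      rw [hc1]
      linear_combination -(1 / 5) * (a.1 * hu + (a.1 * u.2 ^ 2 - a.2 * u.1 * u.2) * hσ')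
    · convert h1.2 using 2
      simp only [hdd] at hc2 ⊢
      rw [hc2]
      linear_combination -(1 / 5) * (a.2 * hu + (a.2 * u.1 ^ 2 - a.1 * u.1 * u.2) * hσ')
  have hd2 : d.1 = -a.1 ∧ d.2 = -a.2 := by
    have : (d.1 + a.1) ^ 2 + (d.2 + a.2) ^ 2 = 0 := by linear_combination hd1 + ha1 + 2 * hdot
    constructor <;> nlinarith [sq_nonneg (d.1 + a.1), sq_nonneg (d.2 + a.2)]
  have hu1 : u.1 = -e.1 * a.1 - σ * e.2 * a.2 := by
    simp only [hdd] at hd2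
    linear_combination -u.1 * he1 - u.1 * e.2 ^ 2 * hσ' + e.1 * hd2.1 + σ * e.2 * hd2.2
  have hu2 : u.2 = -e.1 * a.2 + σ * e.2 * a.1 := by
    simp only [hdd] at hd2
    linear_combination -u.2 * he1 - u.2 * e.2 ^ 2 * hσ' + e.1 * hd2.2 - σ * e.2 * hd2.1
  -- With `d = -a`, the axes of `g` are integer expressions in `e`, `a` and the sign.
  refine ⟨p, hp, g, (-e.1 * a.1 - σ * e.2 * a.2, -e.1 * a.2 + σ * e.2 * a.1),
    (-σ * (-e.1 * a.2 + σ * e.2 * a.1), σ * (-e.1 * a.1 - σ * e.2 * a.2)), ?_, ?_, ht'⟩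
  · have h1 := he.1
    have h2 := hab.1
    have key : (-e.1 * a.1 - σ * e.2 * a.2) ^ 2 + (-e.1 * a.2 + σ * e.2 * a.1) ^ 2 = 1 := by
      linear_combination (a.1 ^ 2 + a.2 ^ 2) * (h1 + e.2 ^ 2 * hσ) + h2
    refine ⟨key, ?_, by ring⟩
    linear_combination σ ^ 2 * key + hσ
  · intro x y
    rw [hg, hc1, hc2, hd2.1, hd2.2, hu1, hu2, pt_inj]
    push_cast [Prod.fst_add, Prod.snd_add]
    constructor <;> ring

/-- Each edge midpoint is a bump or a nick, so some tile matches it there. This is another tile,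
since no tile has both at one point. -/
theorem exists_placed_neighbour {T : Set MarkedTile} (hT : IsTessellation robinsonTiles T)
    {t : MarkedTile} {z a b : ℤ × ℤ} (ht : t ∈ T) (hz : Placed t z) (hab : IsFrame a b) :
    ∃ t' ∈ T, Placed t' (z + a) := by
  have hz' := hz.tileAt
  by_cases h : edgePt z a ∈ t.bumps
  · obtain ⟨t', ht', hx⟩ := hT.bump_fits t ht _ h
    obtain ⟨p, hp, g, e⟩ := hT.copies t' ht'
    refine ⟨t', ht', placed_of_edgePt_mem hz' hp e (hT.no_overlap t ht t' ht' ?_) hab (Or.inr hx)⟩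
    rintro rfl
    exact (hz'.mem_nicks_iff hab).1 hx h
  · rw [← hz'.mem_nicks_iff hab] at h
    obtain ⟨t', ht', hx⟩ := hT.nick_fits t ht _ h
    obtain ⟨p, hp, g, e⟩ := hT.copies t' ht'
    refine ⟨t', ht', placed_of_edgePt_mem hz' hp e (hT.no_overlap t ht t' ht' ?_) hab (Or.inl hx)⟩
    rintro rfl
    exact (hz'.mem_nicks_iff hab).1 h hx

theorem exists_placed {T : Set MarkedTile} (hT : IsTessellation robinsonTiles T)
    {t : MarkedTile} (ht : t ∈ T) (h0 : Placed t 0) (z : ℤ × ℤ) : ∃ t ∈ T, Placed t z := by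
  have step : ∀ z a b, IsFrame a b → (∃ t ∈ T, Placed t z) → ∃ t ∈ T, Placed t (z + a) :=
    fun z a b hab ⟨t, ht, hz⟩ => exists_placed_neighbour hT ht hz hab
  obtain ⟨x, y⟩ := z
  have hx : ∃ t ∈ T, Placed t (x, 0) := by
    induction x with
    | zero => exact ⟨t, ht, h0⟩
    | succ i ih => simpa using step _ _ _ IsFrame.std ih
    | pred i ih => simpa [sub_eq_add_neg] using step _ _ _ IsFrame.std.neg_left ih
  induction y with
  | zero => exact hx
  | succ i ih => simpa using step _ _ _ IsFrame.std.symm ih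
  | pred i ih => simpa [sub_eq_add_neg] using step _ _ _ IsFrame.std.symm.neg_left ih

/-- Every tile overlaps a tile at a lattice point. -/
theorem exists_eq_of_forall_placed {T : Set MarkedTile} (hT : IsTessellation robinsonTiles T)
    {f : ℤ × ℤ → MarkedTile} (hf : ∀ z, f z ∈ T ∧ Placed (f z) z) {t : MarkedTile} (ht : t ∈ T) :
    ∃ z, t = f z := by
  obtain ⟨p, hp, g, rfl⟩ := hT.copies t ht
  obtain ⟨c, u, s, hs, hu, hg⟩ := exists_realFrameAt g
  refine ⟨(round c.1, round c.2), ?_⟩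
  by_contra hne
  have h1 := abs_sub_round c.1
  have h2 := abs_sub_round c.2
  set z : ℤ × ℤ := (round c.1, round c.2)
  have hb : -1 ≤ u.1 ∧ u.1 ≤ 1 := by
    constructor <;> nlinarith [sq_nonneg u.2, sq_nonneg (u.1 + 1), sq_nonneg (u.1 - 1)]
  have hb' : -1 ≤ u.2 ∧ u.2 ≤ 1 := by
    constructor <;> nlinarith [sq_nonneg u.1, sq_nonneg (u.2 + 1), sq_nonneg (u.2 - 1)]
  have hs2 : s ^ 2 = 1 := by rcases hs with rfl | rfl <;> norm_num
  have hs1 : |s| = 1 := by rcases hs with rfl | rfl <;> norm_num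
  have hab : ∀ p q v w : ℝ, |p| ≤ 1 / 2 → |q| ≤ 1 / 2 → |v| ≤ 1 → |w| ≤ 1 →
      |(p * v + q * w) / 4| < 1 / 2 := fun p q v w hp hq hv hw => by
    have e1 : |p * v| ≤ 1 / 2 * 1 := by rw [abs_mul]; gcongr
    have e2 : |q * w| ≤ 1 / 2 * 1 := by rw [abs_mul]; gcongr
    have := abs_add_le (p * v) (q * w)
    rw [abs_div, abs_of_pos (by norm_num : (0 : ℝ) < 4)]
    linarith
  have h1' : |(round c.1 : ℝ) - c.1| ≤ 1 / 2 := by rwa [abs_sub_comm]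
  have h2' : |(round c.2 : ℝ) - c.2| ≤ 1 / 2 := by rwa [abs_sub_comm]
  -- The image of this point is `c + (z - c) / 4`. The centre `c` itself may lie on the boundary of
  -- the lattice square; a quarter of the way towards `z` is interior to both squares.
  have h3 := map_mem_interior hp g
    (hab _ _ u.1 u.2 h1' h2' (abs_le.2 hb) (abs_le.2 hb'))
    (hab _ _ (-s * u.2) (s * u.1) h1' h2'
      (by rw [abs_mul, abs_neg, hs1, one_mul]; exact abs_le.2 hb')
      (by rw [abs_mul, hs1, one_mul]; exact abs_le.2 hb))
  refine Set.disjoint_left.1 (hT.no_overlap _ ht _ (hf z).1 hne) h3 ?_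
  rw [(hf z).2.tileAt.region, hg]
  have key : ∀ r : ℝ, |r - round r| ≤ 1 / 2 → |3 / 4 * (r - round r)| < 1 / 2 := fun r hr => by
    rw [abs_mul, abs_of_pos (by norm_num : (0 : ℝ) < 3 / 4)]
    linarith
  refine mem_interior_latticeSquare ?_ ?_
  · convert key c.1 h1 using 2
    simp only [z]
    linear_combination (1 / 4 * (round c.1 - c.1)) * hu +
      1 / 4 * ((round c.1 - c.1) * u.2 ^ 2 - (round c.2 - c.2) * u.1 * u.2) * hs2
  · convert key c.2 h2 using 2
    simp only [z]
    linear_combination (1 / 4 * (round c.2 - c.2)) * hu +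
      1 / 4 * ((round c.2 - c.2) * u.1 ^ 2 - (round c.1 - c.1) * u.1 * u.2) * hs2

/-- Every tessellation by Robinson tiles is congruent to one that has a tile at each lattice
point. -/
theorem IsTessellation.exists_lattice {T : Set MarkedTile} (hT : IsTessellation robinsonTiles T) :
    ∃ (g : Plane ≃ᵢ Plane) (f : ℤ × ℤ → MarkedTile), (∀ z, TileAt (f z) z) ∧
      MarkedTile.map g '' T = Set.range f := by
  obtain ⟨t, ht, -⟩ := hT.covers 0
  obtain ⟨p, hp, g, rfl⟩ := hT.copies t ht
  -- Undoing the isometry of one tile puts that tile in standard position at the origin.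
  have hT' := hT.map g.symm
  have hp0 : Placed p 0 := ⟨p, hp, IsometryEquiv.refl Plane, _, _, IsFrame.std,
    fun a b => by simp; rfl, (MarkedTile.map_refl p).symm⟩
  have hpT : p ∈ MarkedTile.map g.symm '' T := ⟨_, ht, by
    rw [MarkedTile.map_map, show g.trans g.symm = IsometryEquiv.refl Plane from
      IsometryEquiv.ext g.symm_apply_apply, MarkedTile.map_refl]⟩
  choose f hf using exists_placed hT' hpT hp0
  refine ⟨g.symm, f, fun z => (hf z).2.tileAt, Set.Subset.antisymm (fun t ht => ?_) ?_⟩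
  · obtain ⟨z, rfl⟩ := exists_eq_of_forall_placed hT' hf ht
    exact ⟨z, rfl⟩
  · rintro _ ⟨z, rfl⟩
    exact (hf z).1

/-! ### Absence of periods -/

/-- Conjugating a translation by an isometry gives the translation by the image of the vector under
the linear part. -/
theorem IsPeriodic.map {T : Set MarkedTile} (h : IsPeriodic T) (g : Plane ≃ᵢ Plane) :
    IsPeriodic (MarkedTile.map g '' T) := by
  obtain ⟨v, hv, e⟩ := h
  set L := g.toRealAffineIsometryEquiv.linearIsometryEquiv
  have hg : ∀ x, g (x + v) = g x + L v := fun x => by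
    have := g.toRealAffineIsometryEquiv.map_vadd x v
    simpa [add_comm] using this
  refine ⟨L v, by simpa using hv, ?_⟩
  have : ∀ t : MarkedTile, (t.map g).map (IsometryEquiv.addRight (L v)) =
      (t.map (IsometryEquiv.addRight v)).map g := fun t => by
    rw [MarkedTile.map_map, MarkedTile.map_map]
    congr 1
    ext1 x
    exact (hg x).symm
  rw [Set.image_image]
  simp only [this]
  rw [← Set.image_image, e]

theorem not_isPeriodic {T : Set MarkedTile} (hT : IsTessellation robinsonTiles T) :
    ¬ IsPeriodic T := by
  intro h
  obtain ⟨g, f, hf, e⟩ := hT.exists_lattice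
  obtain ⟨v, hv, hTv⟩ := h.map g
  have hT' := hT.map g
  rw [e] at hTv hT'
  have F := hT'.robinsonField hf rfl
  have hshift : ∀ z, ∃ z', (f z).map (IsometryEquiv.addRight v) = f z' ∧
      z'.1 = z.1 + v 0 ∧ z'.2 = z.2 + v 1 := fun z => by
    have : (f z).map (IsometryEquiv.addRight v) ∈ Set.range f := by
      rw [← hTv]; exact ⟨_, ⟨z, rfl⟩, rfl⟩
    obtain ⟨z', hz'⟩ := this
    refine ⟨z', hz'.symm, ?_⟩
    have hr : latticeSquare z' = IsometryEquiv.addRight v '' latticeSquare z := by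
      rw [← (hf z).region, ← (hf z').region, hz']
      rfl
    have := latticeSquare_subset (z := z') (x := z.1 + v 0) (y := z.2 + v 1) (by
      rw [hr]
      rintro _ ⟨x, ⟨h0, h1⟩, rfl⟩
      simp only [Set.mem_ofPred_eq, IsometryEquiv.addRight_apply, PiLp.add_apply,
        add_sub_add_right_eq_sub]
      exact ⟨h0, h1⟩)
    exact ⟨this.1.symm, this.2.symm⟩
  -- The tile at the origin moves to a lattice tile, so `v` has integer coordinates.
  obtain ⟨V, -, hV0, hV1⟩ := hshift 0
  have hV : ∀ z, (f z).map (IsometryEquiv.addRight v) = f (z + V) := fun z => by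
    obtain ⟨z', hz', h0, h1⟩ := hshift z
    have : z' = z + V := by
      ext
      · have : (z'.1 : ℝ) = (z.1 + V.1 : ℤ) := by push_cast; rw [h0, hV0]; simp
        exact_mod_cast this
      · have : (z'.2 : ℝ) = (z.2 + V.2 : ℤ) := by push_cast; rw [h1, hV1]; simp
        exact_mod_cast this
    rw [hz', this]
  have hq : ∀ a : ℤ × ℤ, IsometryEquiv.addRight v (quarterPt a) = quarterPt (a + 4 • V) := by
    intro a
    have hv0 : v 0 = V.1 := by rw [hV0]; simp
    have hv1 : v 1 = V.2 := by rw [hV1]; simp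
    rw [IsometryEquiv.addRight_apply, ← pt_eta (quarterPt a + v), quarterPt, quarterPt, pt_inj]
    simp only [PiLp.add_apply, pt_zero, pt_one, hv0, hv1, Prod.fst_add, Prod.snd_add,
      Prod.smul_fst, Prod.smul_snd]
    push_cast [nsmul_eq_mul]
    constructor <;> ring
  have hV' := F.eq_zero_of_period (v := V)
    (fun z a b hl => by
      rw [← hV]
      refine ⟨_, hl, ?_⟩
      rw [endPt, hq, endPt]
      congr 1
      module)
    (fun z hl => by
      rw [← hV]
      refine ⟨_, hl, ?_⟩
      rw [vertexPt, hq, vertexPt]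
      congr 1
      module)
  apply hv
  rw [hV'] at hV0 hV1
  rw [← pt_eta v, ← pt_eta 0, pt_inj]
  simpa [eq_comm] using And.intro hV0 hV1

/-! ### Assembling tessellations from lattice tiles -/

theorem exists_frameAt {u w : ℤ × ℤ} (z : ℤ × ℤ) (hf : IsFrame u w) :
    ∃ g : Plane ≃ᵢ Plane, FrameAt g z u w := by
  have h1 : (u.1 : ℝ) ^ 2 + (u.2 : ℝ) ^ 2 = 1 := by exact_mod_cast hf.1
  have h2 : (w.1 : ℝ) ^ 2 + (w.2 : ℝ) ^ 2 = 1 := by exact_mod_cast hf.2.1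
  have h3 : (u.1 : ℝ) * w.1 + u.2 * w.2 = 0 := by exact_mod_cast hf.2.2
  have h4 : (u.1 : ℝ) ^ 2 + (w.1 : ℝ) ^ 2 = 1 ∧ (u.2 : ℝ) ^ 2 + (w.2 : ℝ) ^ 2 = 1 ∧
      (u.1 : ℝ) * u.2 + w.1 * w.2 = 0 := by
    obtain ⟨rfl | rfl, rfl | rfl⟩ | ⟨rfl | rfl, rfl | rfl⟩ := hf.eq_or <;> norm_num
  refine ⟨IsometryEquiv.mk ⟨fun p => pt (z.1 + p 0 * u.1 + p 1 * w.1) (z.2 + p 0 * u.2 + p 1 * w.2),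
    fun q => pt ((q 0 - z.1) * u.1 + (q 1 - z.2) * u.2) ((q 0 - z.1) * w.1 + (q 1 - z.2) * w.2),
    fun p => ?_, fun q => ?_⟩ (Isometry.of_dist_eq fun p q => ?_), fun a b => rfl⟩
  · rw [← pt_eta p, pt_inj]
    simp only [pt_zero, pt_one]
    constructor
    · linear_combination p 0 * h1 + p 1 * h3
    · linear_combination p 0 * h3 + p 1 * h2
  · rw [← pt_eta q, pt_inj]
    simp only [pt_zero, pt_one]
    constructor
    · linear_combination (q 0 - z.1) * h4.1 + (q 1 - z.2) * h4.2.2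
    · linear_combination (q 0 - z.1) * h4.2.2 + (q 1 - z.2) * h4.2.1
  · simp only [EuclideanSpace.dist_eq, Fin.sum_univ_two, Real.dist_eq, sq_abs, pt_zero, pt_one]
    congr 1
    linear_combination (p 0 - q 0) ^ 2 * h1 + (p 1 - q 1) ^ 2 * h2 +
      2 * (p 0 - q 0) * (p 1 - q 1) * h3

theorem exists_cross {u w : ℤ × ℤ} (z : ℤ × ℤ) (hf : IsFrame u w) (c : Prop) :
    ∃ t, Placed t z ∧ IsCrossAt t z u w c := by
  classical
  obtain ⟨g, hg⟩ := exists_frameAt z hf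
  refine ⟨_, ⟨_, mem_robinsonTiles.2 (Or.inl ⟨_, rfl⟩), g, u, w, hf, hg, rfl⟩,
    by simpa using isCrossAt_map hf hg (decide c)⟩

theorem exists_passing {u w : ℤ × ℤ} (z : ℤ × ℤ) (hf : IsFrame u w) (al ac : Prop) :
    ∃ t, Placed t z ∧ IsPassingAt t z u w al ac := by
  classical
  obtain ⟨g, hg⟩ := exists_frameAt z hf
  refine ⟨_, ⟨_, mem_robinsonTiles.2 (Or.inr ⟨_, _, rfl⟩), g, u, w, hf, hg, rfl⟩,
    by simpa using isPassingAt_map hf hg (decide al) (decide ac)⟩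

/-- The coordinate projections are open maps, so they send the interior of the square into the
interior of an interval. -/
theorem interior_latticeSquare_subset {z : ℤ × ℤ} :
    interior (latticeSquare z) ⊆ {p | |p 0 - z.1| < 1 / 2 ∧ |p 1 - z.2| < 1 / 2} := by
  have key : ∀ (i : Fin 2) (c : ℝ), latticeSquare z ⊆ {p | |p i - c| ≤ 1 / 2} →
      ∀ p ∈ interior (latticeSquare z), |p i - c| < 1 / 2 := by
    intro i c hsub p hp
    have hopen : IsOpenMap (EuclideanSpace.proj i : Plane →L[ℝ] ℝ) :=
      ContinuousLinearMap.isOpenMap _ fun r => ⟨pt r r, by fin_cases i <;> simp⟩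
    have h1 := hopen.interior_preimage_subset_preimage_interior (s := Metric.closedBall c (1 / 2))
      (interior_mono (fun q hq => by simpa [Real.dist_eq] using hsub hq) hp)
    rw [interior_closedBall _ (by norm_num)] at h1
    simpa [Real.dist_eq] using h1
  exact fun p hp => ⟨key 0 _ (fun _ h => h.1) p hp, key 1 _ (fun _ h => h.2) p hp⟩

/-- A family of Robinson tiles at the lattice points that obey Robinson's rules is a
tessellation. -/
theorem isTessellation_range {f : ℤ × ℤ → MarkedTile} (hf : ∀ z, Placed (f z) z)
    (hout : ∀ z u w, IsFrame u w →
      (edgePt (z + u) (-u) ∈ (f (z + u)).bumps ↔ edgePt z u ∉ (f z).bumps))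
    (hline : ∀ z u w, IsFrame u w → endPt z u w ∈ (f z).lineEnds →
      endPt (z + u) (-u) w ∈ (f (z + u)).lineEnds)
    (hcrn : ∀ z u w, IsFrame u w → ∃ z', vertexPt z u w ∈ (f z').cornered ∧
      ∀ y, vertexPt z u w ∈ (f y).cornered → y = z') :
    IsTessellation robinsonTiles (Set.range f) := by
  have ht := fun z => (hf z).tileAt
  refine ⟨?_, ?_, ?_, ?_, ?_, ?_, ?_⟩
  · rintro _ ⟨z, rfl⟩
    obtain ⟨p, hp, g, u, w, -, -, e⟩ := hf z
    exact ⟨p, hp, g, e⟩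
  · intro x
    refine ⟨_, ⟨(round (x 0), round (x 1)), rfl⟩, ?_⟩
    rw [(ht _).region]
    exact ⟨abs_sub_round _, abs_sub_round _⟩
  · rintro _ ⟨z, rfl⟩ _ ⟨z', rfl⟩ hne
    rw [(ht z).region, (ht z').region, Set.disjoint_left]
    intro p hp hp'
    have key : ∀ (c : ℝ) (i j : ℤ), |c - i| < 1 / 2 → |c - j| < 1 / 2 → i = j := by
      intro c i j hi hj
      rw [abs_lt] at hi hj
      have h1 : (i : ℝ) < j + 1 := by linarith
      have h2 : (j : ℝ) < i + 1 := by linarith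
      have h1 : i < j + 1 := by exact_mod_cast h1
      have h2 : j < i + 1 := by exact_mod_cast h2
      omega
    have h1 := interior_latticeSquare_subset hp
    have h2 := interior_latticeSquare_subset hp'
    exact hne (by rw [Prod.ext (key _ _ _ h1.1 h2.1) (key _ _ _ h1.2 h2.2)])
  · rintro _ ⟨z, rfl⟩ x hx
    obtain ⟨a, b, hab, rfl⟩ := (ht z).exists_of_mem_bumps hx
    refine ⟨_, ⟨z + a, rfl⟩, ?_⟩
    rw [← edgePt_add_neg, (ht _).mem_nicks_iff hab.neg_left, hout z a b hab]
    exact not_not.2 hx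
  · rintro _ ⟨z, rfl⟩ x hx
    obtain ⟨a, b, hab, rfl⟩ := (ht z).exists_of_mem_nicks hx
    refine ⟨_, ⟨z + a, rfl⟩, ?_⟩
    rw [← edgePt_add_neg, hout z a b hab]
    exact ((ht z).mem_nicks_iff hab).1 hx
  · rintro _ ⟨z, rfl⟩ x hx
    obtain ⟨a, b, hab, rfl⟩ := (ht z).exists_of_mem_lineEnds hx
    refine ⟨_, ⟨z + a, rfl⟩, fun h => ?_, ?_⟩
    · have h1 := (ht (z + a)).eq (h ▸ ht z)
      have : a = 0 := by simpa using h1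
      rw [this] at hab
      exact absurd hab.1 (by norm_num)
    · have := hline z a b hab hx
      rwa [endPt_add_neg] at this
  · rintro _ ⟨z, rfl⟩ x hx
    obtain ⟨a, b, hab, rfl⟩ := (ht z).exists_of_mem_vertices hx
    obtain ⟨z', hz', hu⟩ := hcrn z a b hab
    refine ⟨f z', ⟨⟨z', rfl⟩, hz'⟩, ?_⟩
    rintro _ ⟨⟨y, rfl⟩, hy⟩
    rw [hu y hy]

/-! ### The tiling defined by a ruler -/

/-- The binary expansions `b x`, for `x : ℤ`, of consecutive 2-adic integers different from `0`;
`lev x` is the 2-adic valuation of the one with index `x`. -/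
structure IsRuler (b : ℤ → ℕ → Bool) (lev : ℤ → ℕ) : Prop where
  at_lev : ∀ x, b x (lev x) = true
  below : ∀ x i, i < lev x → b x i = false
  pred_of_le : ∀ x i, i ≤ lev x → b (x - 1) i = !b x i
  pred_of_lt : ∀ x i, lev x < i → b (x - 1) i = b x i

/-- The direction in which the elbow of a cross points. -/
def bitSign (c : Bool) : ℤ := if c then -1 else 1

theorem bitSign_eq (c : Bool) : bitSign c = 1 ∨ bitSign c = -1 := by
  cases c <;> simp [bitSign]

/-- The markings of the tile at `(x, y)` in the tiling defined by a ruler. -/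
structure RulerMarks (b : ℤ → ℕ → Bool) (lev : ℤ → ℕ) (t : MarkedTile) (x y : ℤ) : Prop where
  right : edgePt (x, y) (1, 0) ∈ t.bumps ↔ b x (lev y) = true
  left : edgePt (x, y) (-1, 0) ∈ t.bumps ↔ b (x - 1) (lev y) = false
  top : edgePt (x, y) (0, 1) ∈ t.bumps ↔ b y (lev x) = true
  bottom : edgePt (x, y) (0, -1) ∈ t.bumps ↔ b (y - 1) (lev x) = false
  line_right : ∀ s : ℤ, s = 1 ∨ s = -1 → (endPt (x, y) (1, 0) (0, s) ∈ t.lineEnds ↔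
    b x (lev y) ≠ b x (lev y + 1) ∧ s = bitSign (b y (lev y + 1)))
  line_left : ∀ s : ℤ, s = 1 ∨ s = -1 → (endPt (x, y) (-1, 0) (0, s) ∈ t.lineEnds ↔
    b (x - 1) (lev y) ≠ b (x - 1) (lev y + 1) ∧ s = bitSign (b y (lev y + 1)))
  line_top : ∀ s : ℤ, s = 1 ∨ s = -1 → (endPt (x, y) (0, 1) (s, 0) ∈ t.lineEnds ↔
    b y (lev x) ≠ b y (lev x + 1) ∧ s = bitSign (b x (lev x + 1)))
  line_bottom : ∀ s : ℤ, s = 1 ∨ s = -1 → (endPt (x, y) (0, -1) (s, 0) ∈ t.lineEnds ↔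
    b (y - 1) (lev x) ≠ b (y - 1) (lev x + 1) ∧ s = bitSign (b x (lev x + 1)))
  cornered : ∀ u w, IsFrame u w →
    (vertexPt (x, y) u w ∈ t.cornered ↔ lev x = 0 ∧ lev y = 0)

theorem isFrame_horizontal {s r : ℤ} (hs : s = 1 ∨ s = -1) (hr : r = 1 ∨ r = -1) :
    IsFrame (s, 0) (0, r) := by
  rcases hs with rfl | rfl <;> rcases hr with rfl | rfl <;> norm_num [IsFrame]

namespace IsRuler

variable {b : ℤ → ℕ → Bool} {lev : ℤ → ℕ}

/-- A cross. The bit above the valuation tells on which side the nearest index of the next level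
lies, and the elbow points there in both coordinates. -/
theorem exists_tile_of_eq (R : IsRuler b lev) {x y : ℤ} (h : lev x = lev y) :
    ∃ t, Placed t (x, y) ∧ RulerMarks b lev t x y := by
  have hf := isFrame_horizontal (bitSign_eq (b x (lev x + 1))) (bitSign_eq (b y (lev y + 1)))
  obtain ⟨t, ht, hc⟩ := exists_cross (x, y) hf (lev x = 0)
  have hR := IsFrame.std
  have hbump : ∀ a b, IsFrame a b → edgePt (x, y) a ∈ t.bumps :=
    fun a b hab => (hc.bumps _).2 ⟨a, b, hab, rfl⟩
  have hline : ∀ a b, IsFrame a b → (endPt (x, y) a b ∈ t.lineEnds ↔ _) := fun a b hab => by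
    rw [hc.lineEnds, TileAt.endPt_inj hab hf, TileAt.endPt_inj hab hf.symm]
  have e1 := R.at_lev x
  have e2 := R.at_lev y
  have e3 := R.pred_of_le x (lev x) le_rfl
  have e4 := R.pred_of_lt x (lev x + 1) (by omega)
  have e5 := R.pred_of_le y (lev y) le_rfl
  have e6 := R.pred_of_lt y (lev y + 1) (by omega)
  refine ⟨t, ht, ?_, ?_, ?_, ?_, ?_, ?_, ?_, ?_, ?_⟩
  · exact iff_of_true (hbump _ _ hR) (h ▸ e1)
  · exact iff_of_true (hbump _ _ hR.neg_left) (by rw [← h, e3, e1]; rfl)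
  · exact iff_of_true (hbump _ _ hR.symm) (h ▸ e2)
  · exact iff_of_true (hbump _ _ hR.symm.neg_left) (by rw [h, e5, e2]; rfl)
  · intro s hs
    rw [hline _ _ (isFrame_horizontal (Or.inl rfl) hs), ← h, e1]
    cases b x (lev x + 1) <;> simp [bitSign, h]
  · intro s hs
    rw [hline _ _ (isFrame_horizontal (Or.inr rfl) hs), ← h, e3, e4, e1]
    cases b x (lev x + 1) <;> simp [bitSign, h]
  · intro s hs
    rw [hline _ _ (isFrame_horizontal hs (Or.inl rfl)).symm, h, e2]
    cases b y (lev y + 1) <;> simp [bitSign]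
  · intro s hs
    rw [hline _ _ (isFrame_horizontal hs (Or.inr rfl)).symm, h, e5, e6, e2]
    cases b y (lev y + 1) <;> simp [bitSign]
  · intro u w huw
    rw [hc.cornered, ← h, and_self]
    exact ⟨fun h => h.1, fun h => ⟨h, u, w, huw, rfl⟩⟩

/-- The arrow runs along the row, whose level is higher. The transverse line belongs to a side of a
square formed by crosses of level `lev x`; such a side meets the row only at its midpoint, which
requires `lev y = lev x + 1`. -/
theorem exists_tile_of_lt (R : IsRuler b lev) {x y : ℤ} (h : lev x < lev y) :
    ∃ t, Placed t (x, y) ∧ RulerMarks b lev t x y := by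
  have hδ : -bitSign (b x (lev y)) = 1 ∨ -bitSign (b x (lev y)) = -1 := by
    cases b x (lev y) <;> simp [bitSign]
  have hf := (isFrame_horizontal hδ (bitSign_eq (b y (lev y + 1)))).symm
  obtain ⟨t, ht, hc⟩ := exists_passing (x, y) hf (b x (lev y) ≠ b x (lev y + 1))
    (lev y = lev x + 1)
  have hR := IsFrame.std
  have hline : ∀ a b, IsFrame a b → (endPt (x, y) a b ∈ t.lineEnds ↔ _) := fun a b hab => by
    rw [hc.lineEnds, TileAt.endPt_inj hab hf.symm, TileAt.endPt_inj hab hf.symm.neg_left,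
      TileAt.endPt_inj hab hf.neg_right, TileAt.endPt_inj hab hf.neg_left.neg_right]
  have e1 := R.pred_of_lt x (lev y) h
  have e2 := R.pred_of_lt x (lev y + 1) (by omega)
  have e3 := R.below y (lev x) h
  have e4 := R.pred_of_le y (lev x) h.le
  have e5 := R.pred_of_le y (lev x + 1) (by omega)
  have e6 : b y (lev x + 1) = decide (lev y = lev x + 1) := by
    rcases (Nat.succ_le_of_lt h).eq_or_lt with h' | h'
    · rw [← Nat.succ_eq_add_one, h', R.at_lev]; simp
    · rw [R.below y _ h']; symm; simpa using h'.ne'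
  refine ⟨t, ht, ?_, ?_, ?_, ?_, ?_, ?_, ?_, ?_, ?_⟩
  · rw [hc.bumps, TileAt.edgePt_inj hR hf.symm]
    cases b x (lev y) <;> simp [bitSign]
  · rw [hc.bumps, TileAt.edgePt_inj (isFrame_horizontal (Or.inr rfl) (Or.inl rfl)) hf.symm, e1]
    cases b x (lev y) <;> simp [bitSign]
  · rw [hc.bumps, TileAt.edgePt_inj hR.symm hf.symm, e3]
    simp
  · rw [hc.bumps, TileAt.edgePt_inj
      (isFrame_horizontal (Or.inl rfl) (Or.inr rfl)).symm hf.symm, e4, e3]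
    simp
  · intro s hs
    rw [hline _ _ (isFrame_horizontal (Or.inl rfl) hs)]
    cases b x (lev y) <;> simp [bitSign]
  · intro s hs
    rw [hline _ _ (isFrame_horizontal (Or.inr rfl) hs), e1, e2]
    cases b x (lev y) <;> simp [bitSign]
  · intro s hs
    rw [hline _ _ (isFrame_horizontal hs (Or.inl rfl)).symm, e3, e6]
    by_cases h' : lev y = lev x + 1
    · rw [← h']
      cases b y (lev y + 1) <;> simp [bitSign]
    · simp [h']
  · intro s hs
    rw [hline _ _ (isFrame_horizontal hs (Or.inr rfl)).symm, e4, e5, e3, e6]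
    by_cases h' : lev y = lev x + 1
    · rw [← h']
      cases b y (lev y + 1) <;> simp [bitSign]
    · simp [h']
  · intro u w huw
    exact iff_of_false (hc.cornered _) fun h' => by omega

/-- The case `lev x < lev y` reflected in the diagonal. -/
theorem exists_tile_of_gt (R : IsRuler b lev) {x y : ℤ} (h : lev y < lev x) :
    ∃ t, Placed t (x, y) ∧ RulerMarks b lev t x y := by
  have hδ : -bitSign (b y (lev x)) = 1 ∨ -bitSign (b y (lev x)) = -1 := by
    cases b y (lev x) <;> simp [bitSign]
  have hf := isFrame_horizontal (bitSign_eq (b x (lev x + 1))) hδ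
  obtain ⟨t, ht, hc⟩ := exists_passing (x, y) hf (b y (lev x) ≠ b y (lev x + 1))
    (lev x = lev y + 1)
  have hR := IsFrame.std
  have hline : ∀ a b, IsFrame a b → (endPt (x, y) a b ∈ t.lineEnds ↔ _) := fun a b hab => by
    rw [hc.lineEnds, TileAt.endPt_inj hab hf.symm, TileAt.endPt_inj hab hf.symm.neg_left,
      TileAt.endPt_inj hab hf.neg_right, TileAt.endPt_inj hab hf.neg_left.neg_right]
  have e1 := R.pred_of_lt y (lev x) h
  have e2 := R.pred_of_lt y (lev x + 1) (by omega)
  have e3 := R.below x (lev y) h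
  have e4 := R.pred_of_le x (lev y) h.le
  have e5 := R.pred_of_le x (lev y + 1) (by omega)
  have e6 : b x (lev y + 1) = decide (lev x = lev y + 1) := by
    rcases (Nat.succ_le_of_lt h).eq_or_lt with h' | h'
    · rw [← Nat.succ_eq_add_one, h', R.at_lev]; simp
    · rw [R.below x _ h']; symm; simpa using h'.ne'
  refine ⟨t, ht, ?_, ?_, ?_, ?_, ?_, ?_, ?_, ?_, ?_⟩
  · rw [hc.bumps, TileAt.edgePt_inj hR hf.symm, e3]
    simp
  · rw [hc.bumps, TileAt.edgePt_inj (isFrame_horizontal (Or.inr rfl) (Or.inl rfl)) hf.symm, e4, e3]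
    simp
  · rw [hc.bumps, TileAt.edgePt_inj hR.symm hf.symm]
    cases b y (lev x) <;> simp [bitSign]
  · rw [hc.bumps, TileAt.edgePt_inj
      (isFrame_horizontal (Or.inl rfl) (Or.inr rfl)).symm hf.symm, e1]
    cases b y (lev x) <;> simp [bitSign]
  · intro s hs
    rw [hline _ _ (isFrame_horizontal (Or.inl rfl) hs), e3, e6]
    by_cases h' : lev x = lev y + 1
    · rw [← h']
      cases b x (lev x + 1) <;> simp [bitSign]
    · simp [h']
  · intro s hs
    rw [hline _ _ (isFrame_horizontal (Or.inr rfl) hs), e4, e5, e3, e6]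
    by_cases h' : lev x = lev y + 1
    · rw [← h']
      cases b x (lev x + 1) <;> simp [bitSign]
    · simp [h']
  · intro s hs
    rw [hline _ _ (isFrame_horizontal hs (Or.inl rfl)).symm]
    cases b y (lev x) <;> simp [bitSign]
  · intro s hs
    rw [hline _ _ (isFrame_horizontal hs (Or.inr rfl)).symm, e1, e2]
    cases b y (lev x) <;> simp [bitSign]
  · intro u w huw
    exact iff_of_false (hc.cornered _) fun h' => by omega

theorem exists_tile (R : IsRuler b lev) (z : ℤ × ℤ) :
    ∃ t, Placed t z ∧ RulerMarks b lev t z.1 z.2 := by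
  rcases lt_trichotomy (lev z.1) (lev z.2) with h | h | h
  exacts [R.exists_tile_of_lt h, R.exists_tile_of_eq h, R.exists_tile_of_gt h]

theorem lev_eq_zero_iff (R : IsRuler b lev) (x : ℤ) : lev x = 0 ↔ b x 0 = true := by
  refine ⟨fun h => h ▸ R.at_lev x, fun h => ?_⟩
  by_contra h'
  rw [R.below x 0 (Nat.pos_of_ne_zero h')] at h
  exact Bool.false_ne_true h

theorem lev_add_eq_zero_iff (R : IsRuler b lev) (x : ℤ) {s : ℤ} (hs : s = 1 ∨ s = -1) :
    lev (x + s) = 0 ↔ lev x ≠ 0 := by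
  rw [R.lev_eq_zero_iff, Ne, R.lev_eq_zero_iff]
  rcases hs with rfl | rfl
  · have := R.pred_of_le (x + 1) 0 (Nat.zero_le _)
    rw [add_sub_cancel_right] at this
    rw [this]
    simp
  · rw [← sub_eq_add_neg, R.pred_of_le x 0 (Nat.zero_le _)]
    simp

/-- The two tiles at an edge read its markings from the same bits, so they agree. Level zero and
positive level alternate along each axis, so exactly one of the four tiles at a vertex is cornered.
-/
theorem isTessellation (R : IsRuler b lev) {f : ℤ × ℤ → MarkedTile}
    (hf : ∀ z, Placed (f z) z ∧ RulerMarks b lev (f z) z.1 z.2) :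
    IsTessellation robinsonTiles (Set.range f) := by
  have hm : ∀ x y, RulerMarks b lev (f (x, y)) x y := fun x y => (hf (x, y)).2
  refine isTessellation_range (fun z => (hf z).1) ?_ ?_ ?_
  · rintro ⟨x, y⟩ u w huw
    obtain ⟨rfl | rfl, -⟩ | ⟨rfl | rfl, -⟩ := huw.eq_or
    · have h1 := (hm (x + 1) y).left
      rw [add_sub_cancel_right] at h1
      simp [h1, (hm x y).right]
    · have h1 := (hm (x - 1) y).right
      simp [h1, (hm x y).left, ← sub_eq_add_neg]
    · have h1 := (hm x (y + 1)).bottom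
      rw [add_sub_cancel_right] at h1
      simp [h1, (hm x y).top]
    · have h1 := (hm x (y - 1)).top
      simp [h1, (hm x y).bottom, ← sub_eq_add_neg]
  · rintro ⟨x, y⟩ u w huw
    obtain ⟨rfl | rfl, hw⟩ | ⟨rfl | rfl, hw⟩ := huw.eq_or
    · obtain ⟨s, hs, rfl⟩ : ∃ s : ℤ, (s = 1 ∨ s = -1) ∧ w = (0, s) := by
        rcases hw with rfl | rfl <;> simp
      have h1 := (hm (x + 1) y).line_left s hs
      rw [add_sub_cancel_right] at h1
      simp [h1, (hm x y).line_right s hs]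
    · obtain ⟨s, hs, rfl⟩ : ∃ s : ℤ, (s = 1 ∨ s = -1) ∧ w = (0, s) := by
        rcases hw with rfl | rfl <;> simp
      have h1 := (hm (x - 1) y).line_right s hs
      simp [h1, (hm x y).line_left s hs, ← sub_eq_add_neg]
    · obtain ⟨s, hs, rfl⟩ : ∃ s : ℤ, (s = 1 ∨ s = -1) ∧ w = (s, 0) := by
        rcases hw with rfl | rfl <;> simp
      have h1 := (hm x (y + 1)).line_bottom s hs
      rw [add_sub_cancel_right] at h1
      simp [h1, (hm x y).line_top s hs]
    · obtain ⟨s, hs, rfl⟩ : ∃ s : ℤ, (s = 1 ∨ s = -1) ∧ w = (s, 0) := by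
        rcases hw with rfl | rfl <;> simp
      have h1 := (hm x (y - 1)).line_top s hs
      simp [h1, (hm x y).line_bottom s hs, ← sub_eq_add_neg]
  · have key : ∀ z : ℤ × ℤ, ∀ s r : ℤ, (s = 1 ∨ s = -1) → (r = 1 ∨ r = -1) →
        ∃ z', vertexPt z (s, 0) (0, r) ∈ (f z').cornered ∧
          ∀ y, vertexPt z (s, 0) (0, r) ∈ (f y).cornered → y = z' := by
      rintro ⟨x, y⟩ s r hs hr
      have hF := isFrame_horizontal hs hr
      have hcr : ∀ p : ℤ × ℤ, vertexPt (x, y) (s, 0) (0, r) ∈ (f p).cornered ↔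
          (p = (x, y) ∨ p = (x + s, y) ∨ p = (x, y + r) ∨ p = (x + s, y + r)) ∧
            lev p.1 = 0 ∧ lev p.2 = 0 := by
        intro p
        have h0 := (hm x y).cornered _ _ hF
        have h1 := (hm (x + s) y).cornered _ _ hF.neg_left
        have h2 := (hm x (y + r)).cornered _ _ hF.neg_right
        have h3 := (hm (x + s) (y + r)).cornered _ _ hF.neg_left.neg_right
        have e1 := vertexPt_add_neg (z := (x, y)) (a := (s, 0)) (b := (0, r))
        have e2 := vertexPt_add_neg (z := (x, y)) (a := (0, r)) (b := (s, 0))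
        have e3 := vertexPt_add_neg (z := (x, y) + (s, 0)) (a := (0, r)) (b := -(s, 0))
        rw [vertexPt_comm, vertexPt_comm (b := -(s, 0)), e1] at e3
        rw [vertexPt_comm, vertexPt_comm (b := (s, 0))] at e2
        rw [Prod.mk_add_mk, add_zero] at e1
        rw [Prod.mk_add_mk, add_zero] at e2
        rw [Prod.mk_add_mk, Prod.mk_add_mk, add_zero, add_zero] at e3
        rw [e1] at h1
        rw [e2] at h2
        rw [e3] at h3
        constructor
        · intro h
          obtain ⟨a, b, hab, e⟩ := (hf p).1.tileAt.exists_of_mem_vertices (Or.inl h)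
          have h4 := eq_of_vertexPt_eq hF hab e
          simp only [Prod.mk_add_mk, add_zero] at h4
          refine ⟨h4, ?_⟩
          rcases h4 with rfl | rfl | rfl | rfl
          exacts [h0.1 h, h1.1 h, h2.1 h, h3.1 h]
        · rintro ⟨rfl | rfl | rfl | rfl, h⟩
          exacts [h0.2 h, h1.2 h, h2.2 h, h3.2 h]
      have hx := R.lev_add_eq_zero_iff x hs
      have hy := R.lev_add_eq_zero_iff y hr
      refine ⟨(if lev x = 0 then x else x + s, if lev y = 0 then y else y + r), ?_, fun p => ?_⟩
      · rw [hcr]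
        split_ifs <;> simp_all
      · rw [hcr]
        rintro ⟨rfl | rfl | rfl | rfl, h⟩ <;> simp_all
    rintro z u w huw
    obtain ⟨h1, h2⟩ | ⟨h1, h2⟩ := huw.eq_or
    · rcases h1 with rfl | rfl <;> rcases h2 with rfl | rfl <;>
        exact key z _ _ (by simp) (by simp)
    · rw [vertexPt_comm]
      rcases h1 with rfl | rfl <;> rcases h2 with rfl | rfl <;>
        exact key z _ _ (by simp) (by simp)

end IsRuler

/-! ### Rulers from 2-adic integers -/

/-- The successor of a 2-adic integer, given by its binary expansion, as a permutation. -/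
def bitSucc : Equiv.Perm (ℕ → Bool) where
  toFun s i := s i ^^ decide (∀ j < i, s j = true)
  invFun s i := s i ^^ decide (∀ j < i, s j = false)
  left_inv s := by
    ext i
    -- The bits of `s + 1` below `i` all vanish iff those of `s` are all one, so both maps flip the
    -- same bits.
    have : (∀ j < i, (s j ^^ decide (∀ k < j, s k = true)) = false) ↔ ∀ j < i, s j = true := by
      constructor
      · intro h j
        induction j using Nat.strong_induction_on with
        | _ j ih =>
          intro hj
          have := h j hj
          rw [decide_eq_true (fun k hk => ih k hk (hk.trans hj))] at this
          simpa using this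
      · intro h j hj
        rw [decide_eq_true (fun k hk => h k (hk.trans hj)), h j hj]
        rfl
    simp only [this, Bool.xor_assoc, Bool.xor_self, Bool.xor_false]
  right_inv s := by
    ext i
    have : (∀ j < i, (s j ^^ decide (∀ k < j, s k = false)) = true) ↔ ∀ j < i, s j = false := by
      constructor
      · intro h j
        induction j using Nat.strong_induction_on with
        | _ j ih =>
          intro hj
          have := h j hj
          rw [decide_eq_true (fun k hk => ih k hk (hk.trans hj))] at this
          simpa using this
      · intro h j hj
        rw [decide_eq_true (fun k hk => h k (hk.trans hj)), h j hj]
        rfl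
    simp only [this, Bool.xor_assoc, Bool.xor_self, Bool.xor_false]

/-- Neither `0` nor `1` occurs only finitely often in the binary sequence. -/
def IsMixed (s : ℕ → Bool) : Prop := ∀ c, ∀ n, ∃ i, n ≤ i ∧ s i = c

theorem IsMixed.of_eventually_eq {s s' : ℕ → Bool} (h : IsMixed s) (m : ℕ)
    (he : ∀ i, m < i → s' i = s i) : IsMixed s' := by
  intro c n
  obtain ⟨i, hi, hc⟩ := h c (n + m + 1)
  exact ⟨i, by omega, by rw [he i (by omega), hc]⟩

theorem IsMixed.succ {s : ℕ → Bool} (h : IsMixed s) : IsMixed (bitSucc s) := by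
  obtain ⟨m, -, hm⟩ := h false 0
  refine h.of_eventually_eq m fun i hi => ?_
  have : ¬ ∀ j < i, s j = true := fun h' => by simp [h' m hi] at hm
  simp [bitSucc, this]

theorem IsMixed.pred {s : ℕ → Bool} (h : IsMixed s) : IsMixed (bitSucc.symm s) := by
  obtain ⟨m, -, hm⟩ := h true 0
  refine h.of_eventually_eq m fun i hi => ?_
  have : ¬ ∀ j < i, s j = false := fun h' => by simp [h' m hi] at hm
  simp [bitSucc, this]

theorem IsMixed.zpow {s : ℕ → Bool} (h : IsMixed s) (x : ℤ) : IsMixed ((bitSucc ^ x) s) := by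
  induction x with
  | zero => exact h
  | succ i ih =>
    rw [add_comm, zpow_add, zpow_one, Equiv.Perm.mul_apply]
    exact ih.succ
  | pred i ih =>
    rw [sub_eq_neg_add, zpow_add, zpow_neg_one, Equiv.Perm.mul_apply]
    exact ih.pred

/-- The index `x` stands for `s + x`. Adding or subtracting `1` changes only finitely many bits of a
mixed sequence, so `s + x` stays mixed; in particular it is not `0` and has a valuation. -/
theorem IsMixed.exists_isRuler {s : ℕ → Bool} (h : IsMixed s) :
    ∃ b lev, IsRuler b lev ∧ b 0 = s := by
  have hex : ∀ x : ℤ, ∃ n, (bitSucc ^ x) s n = true := fun x =>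
    (h.zpow x true 0).imp fun _ h => h.2
  have hpred : ∀ (x : ℤ) i, (bitSucc ^ (x - 1)) s i = ((bitSucc ^ x) s i ^^
      decide (∀ j < i, (bitSucc ^ x) s j = false)) := fun x i => by
    rw [sub_eq_neg_add, zpow_add, zpow_neg_one, Equiv.Perm.mul_apply]
    rfl
  classical
  refine ⟨fun x => (bitSucc ^ x) s, fun x => Nat.find (hex x), ?_, by simp⟩
  have hbelow : ∀ x i, i < Nat.find (hex x) → (bitSucc ^ x) s i = false := fun x i hi => by
    simpa using Nat.find_min (hex x) hi
  refine ⟨fun x => Nat.find_spec (hex x), hbelow, fun x i hi => ?_, fun x i hi => ?_⟩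
  · rw [hpred, decide_eq_true fun j hj => hbelow x j (hj.trans_le hi), Bool.xor_true]
  · rw [hpred, decide_eq_false fun h' => ?_, Bool.xor_false]
    have := Nat.find_spec (hex x)
    rw [h' _ hi] at this
    exact Bool.false_ne_true this

/-- An injection of the binary sequences into those that are not eventually constant. -/
def interleave (s : ℕ → Bool) (i : ℕ) : Bool := s (i / 2) ^^ decide (i % 2 = 1)

/-- The bits `2 * n` and `2 * n + 1` are `s n` and its negation. -/
theorem isMixed_interleave (s : ℕ → Bool) : IsMixed (interleave s) := by
  intro c n
  by_cases h : s n = c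
  · exact ⟨2 * n, by omega, by simp [interleave, h]⟩
  · refine ⟨2 * n + 1, by omega, ?_⟩
    have h1 : (2 * n + 1) / 2 = n := by omega
    have h2 : (2 * n + 1) % 2 = 1 := by omega
    rw [interleave, h1, h2]
    revert h
    cases s n <;> cases c <;> simp

theorem interleave_injective : Function.Injective interleave := by
  intro s s' h
  ext n
  have := congrFun h (2 * n)
  simpa [interleave] using this

/-! ### Recovering the ruler from the tiling -/

namespace IsRuler

variable {b b' : ℤ → ℕ → Bool} {lev lev' : ℤ → ℕ}

/-- There is an index at which the lowest bits vanish and the other ones have not changed. -/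
theorem exists_low_zero (R : IsRuler b lev) (n : ℕ) : ∀ x, ∃ y, (∀ i < n, b y i = false) ∧
    ∀ i, n ≤ i → b y i = b x i := by
  induction n with
  | zero => exact fun x => ⟨x, by simp, by simp⟩
  | succ n ih =>
    intro x
    obtain ⟨y, hy, hy'⟩ := ih x
    cases hb : b y n with
    | false =>
      refine ⟨y, fun i hi => ?_, fun i hi => hy' i (by omega)⟩
      rcases Nat.lt_succ_iff_lt_or_eq.1 hi with h | rfl
      exacts [hy i h, hb]
    | true =>
      -- Passing to `y - 1` clears bit `n`, keeps the higher bits and sets the lower ones, which the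
      -- induction hypothesis clears again.
      have hl : lev y = n := by
        apply le_antisymm
        · by_contra h
          rw [R.below y n (by omega)] at hb
          exact Bool.false_ne_true hb
        · by_contra h
          have := R.at_lev y
          rw [hy _ (by omega)] at this
          exact Bool.false_ne_true this
      obtain ⟨x', hx, hx'⟩ := ih (y - 1)
      refine ⟨x', fun i hi => ?_, fun i hi => ?_⟩
      · rcases Nat.lt_succ_iff_lt_or_eq.1 hi with h | rfl
        · exact hx i h
        · rw [hx' i le_rfl, R.pred_of_le y i hl.ge, hb]; rfl
      · rw [hx' i (by omega), R.pred_of_lt y i (by omega), hy' i (by omega)]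

theorem lev_eq_iff (R : IsRuler b lev) (x : ℤ) (n : ℕ) :
    lev x = n ↔ b x n = true ∧ ∀ i < n, b x i = false := by
  constructor
  · rintro rfl
    exact ⟨R.at_lev x, R.below x⟩
  · rintro ⟨h1, h2⟩
    rcases lt_trichotomy (lev x) n with h | h | h
    · exact absurd (R.at_lev x) (by simp [h2 _ h])
    · exact h
    · exact absurd h1 (by simp [R.below x n h])

theorem exists_lev_eq (R : IsRuler b lev) (n : ℕ) : ∃ x, lev x = n := by
  obtain ⟨y, hy, -⟩ := R.exists_low_zero n 0
  cases hb : b y n with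
  | true => exact ⟨y, (R.lev_eq_iff y n).2 ⟨hb, hy⟩⟩
  | false =>
    have hn : n ≤ lev y := by
      by_contra h
      have := R.at_lev y
      rw [hy _ (by omega)] at this
      exact Bool.false_ne_true this
    obtain ⟨x, hx, hx'⟩ := R.exists_low_zero n (y - 1)
    refine ⟨x, (R.lev_eq_iff x n).2 ⟨?_, hx⟩⟩
    rw [hx' n le_rfl, R.pred_of_le y n hn, hb]
    rfl

theorem pred (R : IsRuler b lev) (x : ℤ) (n : ℕ) :
    b (x - 1) n = (b x n ^^ decide (∀ i < n, b x i = false)) := by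
  rcases le_or_gt n (lev x) with h | h
  · rw [R.pred_of_le x n h, decide_eq_true fun i hi => R.below x i (hi.trans_le h), Bool.xor_true]
  · rw [R.pred_of_lt x n h, decide_eq_false fun h' => ?_, Bool.xor_false]
    have := R.at_lev x
    rw [h' _ h] at this
    exact Bool.false_ne_true this

/-- A bit of all expansions is determined by the lower bits and its value at one index. -/
theorem bit_eq_of_bit_eq (R : IsRuler b lev) (R' : IsRuler b' lev') {n : ℕ}
    (h : ∀ i < n, ∀ x, b x i = b' x i) {x : ℤ} (hx : b x n = b' x n) (y : ℤ) : b y n = b' y n := by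
  -- Whether bit `n` flips between `x` and `x - 1` depends only on the lower bits, which the two
  -- rulers share.
  have key : ∀ x, b (x - 1) n = b' (x - 1) n ↔ b x n = b' x n := fun x => by
    have : (∀ i < n, b x i = false) ↔ ∀ i < n, b' x i = false :=
      forall₂_congr fun i hi => by rw [h i hi]
    rw [R.pred, R'.pred]
    simp only [this]
    exact ⟨fun h => by simpa using h, fun h => by rw [h]⟩
  obtain ⟨k, rfl⟩ : ∃ k, y = x + k := ⟨y - x, by ring⟩
  induction k with
  | zero => simpa using hx
  | succ i ih =>
    rw [← key, ← add_assoc, add_sub_cancel_right]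
    exact ih
  | pred i ih =>
    rw [← add_sub_assoc, key]
    exact ih

/-- A ruler is determined by the tiling that it defines. -/
theorem eq_of_marks (R : IsRuler b lev) (R' : IsRuler b' lev') {f : ℤ × ℤ → MarkedTile}
    (hf : ∀ x y, RulerMarks b lev (f (x, y)) x y)
    (hf' : ∀ x y, RulerMarks b' lev' (f (x, y)) x y) : b = b' := by
  suffices H : ∀ n, ∀ x, b x n = b' x n by
    funext x n
    exact H n x
  intro n
  induction n using Nat.strong_induction_on with
  | _ n ih =>
    rcases Nat.eq_zero_or_pos n with rfl | hn
    · intro x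
      -- A tile on the diagonal is cornered iff the lowest bit is one.
      have h1 := (hf x x).cornered _ _ IsFrame.std
      rw [(hf' x x).cornered _ _ IsFrame.std, and_self, and_self, R.lev_eq_zero_iff,
        R'.lev_eq_zero_iff] at h1
      exact (Bool.eq_iff_iff.2 h1).symm
    · obtain ⟨m, rfl⟩ : ∃ m, n = m + 1 := ⟨n - 1, by omega⟩
      -- The elbow of a diagonal cross of level `m` reveals bit `m + 1` at one index, and
      -- `bit_eq_of_bit_eq` extends this to all.
      obtain ⟨x, hx⟩ := R.exists_lev_eq m
      have hx' : lev' x = m := by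
        rw [R'.lev_eq_iff]
        rw [R.lev_eq_iff, ih m (by omega)] at hx
        exact ⟨hx.1, fun i hi => by rw [← ih i (by omega)]; exact hx.2 i hi⟩
      refine R.bit_eq_of_bit_eq R' ih (x := x) ?_
      have h0 := R.at_lev x
      have h0' := R'.at_lev x
      have h1 : ∀ s : ℤ, s = 1 ∨ s = -1 → _ := fun s hs =>
        ((hf x x).line_right s hs).symm.trans ((hf' x x).line_right s hs)
      rw [hx] at h0 h1
      rw [hx'] at h0' h1
      rw [h0, h0'] at h1
      have h2 := h1 1 (by simp)
      revert h2
      cases b x (m + 1) <;> cases b' x (m + 1) <;> simp [bitSign]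

end IsRuler

/-! ### Counting congruence classes -/

theorem AreCongruent.refl (T : Set MarkedTile) : AreCongruent T T :=
  ⟨IsometryEquiv.refl Plane, by simp [MarkedTile.map_refl]⟩

theorem AreCongruent.symm {T T' : Set MarkedTile} (h : AreCongruent T T') : AreCongruent T' T := by
  obtain ⟨g, rfl⟩ := h
  refine ⟨g.symm, ?_⟩
  simp only [Set.image_image, MarkedTile.map_map, show g.trans g.symm = IsometryEquiv.refl Plane
    from IsometryEquiv.ext g.symm_apply_apply, MarkedTile.map_refl, Set.image_id']

theorem AreCongruent.trans {T T' T'' : Set MarkedTile} (h : AreCongruent T T')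
    (h' : AreCongruent T' T'') : AreCongruent T T'' := by
  obtain ⟨g, rfl⟩ := h
  obtain ⟨g', rfl⟩ := h'
  exact ⟨g.trans g', by simp only [Set.image_image, MarkedTile.map_map]⟩

/-- An isometry of the plane is determined by the images of three points in general position. -/
theorem isometry_ext {g g' : Plane ≃ᵢ Plane}
    (h1 : g (edgePt 0 (1, 0)) = g' (edgePt 0 (1, 0)))
    (h2 : g (edgePt 0 (0, 1)) = g' (edgePt 0 (0, 1)))
    (h3 : g (edgePt 0 (-1, 0)) = g' (edgePt 0 (-1, 0))) : g = g' := by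
  obtain ⟨c, u, s, -, -, hg⟩ := exists_realFrameAt g
  obtain ⟨c', u', s', -, -, hg'⟩ := exists_realFrameAt g'
  simp only [edgePt, quarterPt] at h1 h2 h3
  rw [hg, hg', pt_inj] at h1 h2 h3
  norm_num at h1 h2 h3
  ext1 p
  rw [← pt_eta p, hg, hg', pt_inj]
  obtain ⟨h1, h1'⟩ := h1
  obtain ⟨h2, h2'⟩ := h2
  obtain ⟨h3, h3'⟩ := h3
  constructor
  -- The coefficients are the barycentric coordinates of `p` with respect to the three points.
  · linear_combination (1 / 2 + p 0 - p 1) * h1 + (1 / 2 - p 0 - p 1) * h3 + 2 * p 1 * h2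
  · linear_combination (1 / 2 + p 0 - p 1) * h1' + (1 / 2 - p 0 - p 1) * h3' + 2 * p 1 * h2'

theorem countable_isometries :
    {g : Plane ≃ᵢ Plane | ∀ a ∈ ({(1, 0), (0, 1), (-1, 0)} : Set (ℤ × ℤ)),
      g (edgePt 0 a) ∈ Set.range quarterPt}.Countable := by
  have hc := Set.countable_range quarterPt
  refine ((hc.prod (hc.prod hc)).preimage_of_injOn (f := fun g : Plane ≃ᵢ Plane =>
    (g (edgePt 0 (1, 0)), g (edgePt 0 (0, 1)), g (edgePt 0 (-1, 0)))) ?_).mono ?_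
  · intro g _ g' _ h
    simp only [Prod.mk.injEq] at h
    exact isometry_ext h.1 h.2.1 h.2.2
  · intro g hg
    exact ⟨hg _ (by simp), hg _ (by simp), hg _ (by simp)⟩

/-- Only countably many tessellations with a tile at each lattice point are congruent to a given
one that has a cross at the origin. -/
theorem countable_congruent {f : ℤ × ℤ → MarkedTile}
    (h0 : ∀ a b, IsFrame a b → edgePt 0 a ∈ (f 0).bumps) :
    {T | AreCongruent (Set.range f) T ∧ ∀ t ∈ T, ∃ z, TileAt t z}.Countable := by
  refine (countable_isometries.image fun g => MarkedTile.map g '' Set.range f).mono ?_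
  rintro _ ⟨⟨g, rfl⟩, hT⟩
  refine ⟨g, fun a ha => ?_, rfl⟩
  obtain ⟨z, hz⟩ := hT _ ⟨_, ⟨0, rfl⟩, rfl⟩
  obtain ⟨b, hab⟩ : ∃ b, IsFrame a b := by
    rcases ha with rfl | rfl | rfl
    exacts [⟨_, IsFrame.std⟩, ⟨_, IsFrame.std.symm⟩, ⟨_, IsFrame.std.neg_left⟩]
  obtain ⟨a', b', -, h⟩ := hz.exists_of_mem_bumps ⟨_, h0 a b hab, rfl⟩
  exact ⟨_, h.symm⟩

/-- An uncountable family of tessellations by Robinson tiles, only countably many of which are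
congruent to a given one. -/
theorem exists_family : ∃ T : (ℕ → Bool) → Set MarkedTile, Function.Injective T ∧
    (∀ s, IsTessellation robinsonTiles (T s)) ∧
    ∀ s, {s' | AreCongruent (T s) (T s')}.Countable := by
  choose b lev R hb using fun s => (isMixed_interleave s).exists_isRuler
  choose f hf using fun s => (R s).exists_tile
  have htile : ∀ s z, TileAt (f s z) z := fun s z => (hf s z).1.tileAt
  have hinj : Function.Injective fun s => Set.range (f s) := by
    intro s s' h
    have he : f s = f s' := by
      funext z
      obtain ⟨z', hz'⟩ : f s z ∈ Set.range (f s') := h.subset ⟨z, rfl⟩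
      rw [← hz', (htile s' z').eq (hz' ▸ htile s z)]
    have := (R s).eq_of_marks (R s') (f := f s) (fun x y => (hf s (x, y)).2)
      (fun x y => he ▸ (hf s' (x, y)).2)
    apply interleave_injective
    rw [← hb, ← hb, this]
  refine ⟨fun s => Set.range (f s), hinj, fun s => (R s).isTessellation (hf s), fun s => ?_⟩
  -- The origin lies on the diagonal, where every tile is a cross.
  have h0 : ∀ a b, IsFrame a b → edgePt 0 a ∈ (f s 0).bumps := by
    intro a c hab
    have h := (hf s 0).2
    have h1 := (R s).at_lev 0
    have h2 := (R s).pred_of_le 0 _ le_rfl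
    rw [h1] at h2
    obtain ⟨rfl | rfl, -⟩ | ⟨rfl | rfl, -⟩ := hab.eq_or
    exacts [h.right.2 h1, h.left.2 h2, h.top.2 h1, h.bottom.2 h2]
  refine ((countable_congruent h0).preimage_of_injOn hinj.injOn).mono fun s' hs' => ?_
  refine ⟨hs', ?_⟩
  rintro _ ⟨z, rfl⟩
  exact ⟨z, htile s' z⟩

theorem not_countable_bits : ¬ Countable (ℕ → Bool) := by
  classical
  intro h
  obtain ⟨e, he⟩ := exists_injective_nat (ℕ → Bool)
  refine Function.cantor_injective (fun s : Set ℕ => e fun i => decide (i ∈ s)) fun s s' h => ?_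
  ext i
  simpa using congrFun (he h) i

theorem mainTheorem2 :
    IsAperiodicSet robinsonTiles ∧
      ∃ S : Set (Set MarkedTile), ¬ S.Countable ∧
        (∀ T ∈ S, IsTessellation robinsonTiles T) ∧
        S.Pairwise (fun T T' => ¬ AreCongruent T T') := by
  obtain ⟨T, hinj, hT, hc⟩ := exists_family
  refine ⟨⟨⟨_, hT fun _ => true⟩, fun _ => not_isPeriodic⟩, ?_⟩
  -- One representative is taken from each congruence class. The classes are countable, so countably
  -- many of them could not exhaust the binary sequences.
  let r : Setoid (ℕ → Bool) := ⟨fun s s' => AreCongruent (T s) (T s'),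
    fun s => .refl _, fun h => h.symm, fun h h' => h.trans h'⟩
  have hout : Function.Injective fun q : Quotient r => T q.out :=
    hinj.comp Quotient.out_injective
  refine ⟨Set.range fun q : Quotient r => T q.out, fun h => ?_, ?_, ?_⟩
  · have : Countable (Quotient r) := by
      have := h.to_subtype
      exact (Set.rangeFactorization_injective.2 hout).countable
    have hu : (Set.univ : Set (ℕ → Bool)).Countable := by
      refine (Set.countable_iUnion fun q : Quotient r => hc q.out).mono fun s _ => ?_
      exact Set.mem_iUnion.2 ⟨⟦s⟧, Quotient.mk_out (s := r) s⟩
    exact not_countable_bits (Set.countable_univ_iff.1 hu)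
  · rintro _ ⟨q, rfl⟩
    exact hT _
  · rintro _ ⟨q, rfl⟩ _ ⟨q', rfl⟩ hne h
    refine hne ?_
    have : q = q' := by
      rw [← Quotient.out_eq q, ← Quotient.out_eq q']
      exact Quotient.sound h
    rw [this]
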